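/- Let $\mathcal C$ be a locally finitely presentable category with initial object $0$, and let $J$ be a (small) set of maps in $\mathcal C$. A *natural weak factorisation system* $(\mathsf L,\mathsf R)$ on $\mathcal C$ consists of a functorial factorisation $f = \rho_f\circ\lambda_f$, $X\xrightarrow{\lambda_f}Pf\xrightarrow{\rho_f}Y$, of the maps $f\colon X\to Y$ of $\mathcal C$, together with maps $\sigma_f\colon Pf\to P\lambda_f$ and $\pi_f\colon P\rho_f\to Pf$, such that $f\mapsto\lambda_f$ underlies a comonad $\mathsf L$ on $\mathcal C^{\mathbf 2}$ with counit $(1,\rho_f)$ and comultiplication $(1,\sigma_f)$, $f\mapsto\rho_f$ underlies a monad $\mathsf R$ on $\mathcal C^{\mathbf 2}$ with unit $(\lambda_f,1)$ and multiplication $(\pi_f,1)$, and the maps $(\sigma_f,\pi_f)\colon\lambda_{\rho_f}\to\rho_{\lambda_f}$ form a distributive law $\mathsf L\mathsf R\Rightarrow\mathsf R\mathsf L$ of $\mathsf L$ over $\mathsf R$. A morphism $(\mathsf L,\mathsf R)\to(\mathsf L',\mathsf R')$ is a natural family $K_f\colon Pf\to P'f$ with $K_f\lambda_f=\lambda'_f$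 and $\rho'_fK_f=\rho_f$ such that $(1,K_f)$ is a morphism of comonads $\mathsf L\to\mathsf L'$ and $(K_f,1)$ is a morphism of monads $\mathsf R\to\mathsf R'$. A *universal algebraic realisation* of $J$ is a natural weak factorisation system $(\mathsf L,\mathsf R)$ together with an $\mathsf L$-coalgebra structure on each $j\in J$, such that every $\rho_f$ has the right lifting property with respect to $J$, every $\lambda_f$ has the left lifting property with respect to all maps with that property, and, for every natural weak factorisation system $(\mathsf L',\mathsf R')$ on $\mathcal C$ with an $\mathsf L'$-coalgebra structure on each $j\in J$, there is a unique morphism $(\mathsf L,\mathsf R)\to(\mathsf L',\mathsf R')$ carrying the given $\mathsf L$-coalgebra structures to the given $\mathsf L'$-coalgebra structures. The *universal cofibrant replacement comonad* of $J$ is then the restriction of $\mathsf L$ to the coslice $0/\mathcal C\cong\mathcal C$; its counit at $X$ is the map $\epsilon_X=\rho_{(0\to X)}\colon QX=P(0\to X)\to X$, the *universal cofibrant replacement* of $X$. A *choice of liftings* for $f\colon Y\to X$ is a function $\phi$ assigning to each $j\colon A\to B$ in $J$ and each commutative square $fh=kj$ (with $h\colon A\to Y$ and $k\colon B\to X$)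 a map $\phi(j,h,k)\colon B\to Y$ with $\phi(j,h,k)\,j=h$ and $f\,\phi(j,h,k)=k$. For an object $X$, the category $\mathbf{AAF}/X$ of algebraic acyclic fibrations into $X$ has as objects the pairs $(f,\phi)$ of a map $f$ with codomain $X$ and a choice of liftings $\phi$ for $f$; a morphism $(f\colon Y\to X,\phi)\to(g\colon Z\to X,\psi)$ is a map $u\colon Y\to Z$ with $gu=f$ and $u\,\phi(j,h,k)=\psi(j,uh,k)$ for all such squares. **Proposition.** A universal algebraic realisation of $J$ exists; and for every universal algebraic realisation of $J$ and every object $X$ of $\mathcal C$, the universal cofibrant replacement $\epsilon_X\colon QX\to X$ may be equipped with a choice of liftings $\phi_X$ such that $(\epsilon_X,\phi_X)$ is an initial object of $\mathbf{AAF}/X$. -/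

import Mathlib

open CategoryTheory CategoryTheory.Limits

universe v u

namespace AlgebraicWFS

attribute [local instance] Cardinal.fact_isRegular_aleph0 in
/-- A locally finitely presentable category is cocomplete, so it has an initial object. -/
instance hasInitial_of_isLocallyFinitelyPresentable (C : Type u) [Category.{v} C]
    [IsLocallyFinitelyPresentable.{v} C] : HasInitial C := by
  have : HasColimitsOfSize.{v, v} C :=
    IsCardinalLocallyPresentable.toHasColimitsOfSize (κ := Cardinal.aleph0.{v})
  have : HasColimitsOfSize.{0, 0} C := hasColimitsOfSizeShrink.{0, 0, v, v} C
  infer_instance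

section Factorisations

variable (C : Type u) [Category.{v} C]

/-- A functorial factorisation `X ⟶ P f ⟶ Y`, written `lam f ≫ rho f`, of every `f : X ⟶ Y`. -/
structure FunctorialFactorisation where
  /-- the middle object `P f`, functorial in `f` -/
  P : Arrow C ⥤ C
  /-- the left part `X ⟶ P f` -/
  lam : Arrow.leftFunc ⟶ P
  /-- the right part `P f ⟶ Y` -/
  rho : P ⟶ Arrow.rightFunc
  fac : ∀ f : Arrow C, lam.app f ≫ rho.app f = f.hom

variable {C}

namespace FunctorialFactorisation

variable (F : FunctorialFactorisation C)

/-- The endofunctor `f ↦ lam f` of the arrow category; a square `(h, k)` goes to `(h, P (h, k))`. -/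
def L : Arrow C ⥤ Arrow C where
  obj f := Arrow.mk (Y := F.P.obj f) (F.lam.app f)
  map {f g} t := Arrow.homMk t.left (F.P.map t) (F.lam.naturality t)

/-- The endofunctor `f ↦ rho f` of the arrow category; a square `(h, k)` goes to `(P (h, k), k)`. -/
def R : Arrow C ⥤ Arrow C where
  obj f := Arrow.mk (X := F.P.obj f) (F.rho.app f)
  map {f g} t := Arrow.homMk (F.P.map t) t.right (F.rho.naturality t)

/-- The transformation `L ⟶ 𝟭` with components `(1, rho f) : lam f ⟶ f`. -/
def counitL : F.L ⟶ 𝟭 (Arrow C) where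
  app f := Arrow.homMk (𝟙 _) (F.rho.app f)
    ((Category.id_comp _).trans (F.fac f).symm)
  naturality f g t := by
    ext
    · exact (Category.comp_id _).trans (Category.id_comp _).symm
    · exact F.rho.naturality t

/-- The transformation `𝟭 ⟶ R` with components `(lam f, 1) : f ⟶ rho f`. -/
def unitR : 𝟭 (Arrow C) ⟶ F.R where
  app f := Arrow.homMk (F.lam.app f) (𝟙 _)
    ((F.fac f).trans (Category.comp_id _).symm)
  naturality f g t := by
    ext
    · exact F.lam.naturality t
    · exact (Category.comp_id _).trans (Category.id_comp _).symm

end FunctorialFactorisation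

end Factorisations

/-- A functorial factorisation together with fillers `sigma f : P f ⟶ P (lam f)` and
`pi f : P (rho f) ⟶ P f` making `L` into a comonad, with counit `(1, rho f)` and comultiplication
`(1, sigma f)`, and `R` into a monad, with unit `(lam f, 1)` and multiplication `(pi f, 1)`. The
laws are written out on middle objects; see `comonadL` and `monadR` below. -/
structure ComonadMonadFactorisation (C : Type u) [Category.{v} C] extends
    FunctorialFactorisation C where
  sigma : P ⟶ toFunctorialFactorisation.L ⋙ P
  pi : toFunctorialFactorisation.R ⋙ P ⟶ P
  lam_sigma : ∀ f : Arrow C,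
    lam.app f ≫ sigma.app f = lam.app (toFunctorialFactorisation.L.obj f)
  pi_rho : ∀ f : Arrow C,
    pi.app f ≫ rho.app f = rho.app (toFunctorialFactorisation.R.obj f)
  sigma_rho : ∀ f : Arrow C,
    sigma.app f ≫ rho.app (toFunctorialFactorisation.L.obj f) = 𝟙 (P.obj f)
  sigma_map_counit : ∀ f : Arrow C,
    sigma.app f ≫ P.map (toFunctorialFactorisation.counitL.app f) = 𝟙 (P.obj f)
  sigma_coassoc : ∀ f : Arrow C,
    sigma.app f ≫ P.map (Arrow.homMk (𝟙 _) (sigma.app f)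
        ((Category.id_comp _).trans (lam_sigma f).symm) :
        toFunctorialFactorisation.L.obj f ⟶
          toFunctorialFactorisation.L.obj (toFunctorialFactorisation.L.obj f)) =
      sigma.app f ≫ sigma.app (toFunctorialFactorisation.L.obj f)
  lam_pi : ∀ f : Arrow C,
    lam.app (toFunctorialFactorisation.R.obj f) ≫ pi.app f = 𝟙 (P.obj f)
  map_unit_pi : ∀ f : Arrow C,
    P.map (toFunctorialFactorisation.unitR.app f) ≫ pi.app f = 𝟙 (P.obj f)
  pi_assoc : ∀ f : Arrow C,
    P.map (Arrow.homMk (pi.app f) (𝟙 _)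
        ((pi_rho f).trans (Category.comp_id _).symm) :
        toFunctorialFactorisation.R.obj (toFunctorialFactorisation.R.obj f) ⟶
          toFunctorialFactorisation.R.obj f) ≫ pi.app f =
      pi.app (toFunctorialFactorisation.R.obj f) ≫ pi.app f

namespace ComonadMonadFactorisation

variable {C : Type u} [Category.{v} C] (F : ComonadMonadFactorisation C)

/-- The comonad `L` on the arrow category. -/
def comonadL : Comonad (Arrow C) where
  toFunctor := F.L
  ε := F.counitL
  δ :=
    { app := fun f => Arrow.homMk (𝟙 _) (F.sigma.app f)
        ((Category.id_comp _).trans (F.lam_sigma f).symm)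
      naturality := fun f g t => by
        ext
        · exact (Category.comp_id _).trans (Category.id_comp _).symm
        · exact F.sigma.naturality t }
  coassoc f := by
    ext
    · rfl
    · exact F.sigma_coassoc f
  left_counit f := by
    ext
    · exact Category.id_comp _
    · exact F.sigma_rho f
  right_counit f := by
    ext
    · exact Category.id_comp _
    · exact F.sigma_map_counit f

/-- The monad `R` on the arrow category. -/
def monadR : Monad (Arrow C) where
  toFunctor := F.R
  η := F.unitR
  μ :=
    { app := fun f => Arrow.homMk (F.pi.app f) (𝟙 _)
        ((F.pi_rho f).trans (Category.comp_id _).symm)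
      naturality := fun f g t => by
        ext
        · exact F.pi.naturality t
        · exact (Category.comp_id _).trans (Category.id_comp _).symm }
  assoc f := by
    ext
    · exact F.pi_assoc f
    · rfl
  left_unit f := by
    ext
    · exact F.lam_pi f
    · exact Category.id_comp _
  right_unit f := by
    ext
    · exact F.map_unit_pi f
    · exact Category.id_comp _

/-- The transformation `LR ⟶ RL` with components `(sigma f, pi f) : lam (rho f) ⟶ rho (lam f)`. -/
def exchange :
    F.monadR.toFunctor ⋙ F.comonadL.toFunctor ⟶ F.comonadL.toFunctor ⋙ F.monadR.toFunctor where
  app f := Arrow.homMk (F.sigma.app f) (F.pi.app f)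
    ((F.sigma_rho f).trans (F.lam_pi f).symm)
  naturality f g t := by
    ext
    · exact F.sigma.naturality t
    · exact F.pi.naturality t

end ComonadMonadFactorisation

/-- A distributive law of a comonad `G` over a monad `T`: a transformation `G T ⟶ T G` compatible
with the unit and multiplication of `T` and with the counit and comultiplication of `G`. -/
structure IsDistributiveLaw {D : Type*} [Category* D] (G : Comonad D) (T : Monad D)
    (d : T.toFunctor ⋙ G.toFunctor ⟶ G.toFunctor ⋙ T.toFunctor) : Prop where
  unit : ∀ X, G.map (T.η.app X) ≫ d.app X = T.η.app (G.obj X)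
  mul : ∀ X, G.map (T.μ.app X) ≫ d.app X =
    d.app (T.obj X) ≫ T.map (d.app X) ≫ T.μ.app (G.obj X)
  counit : ∀ X, d.app X ≫ T.map (G.ε.app X) = G.ε.app (T.obj X)
  comul : ∀ X, d.app X ≫ T.map (G.δ.app X) =
    G.δ.app (T.obj X) ≫ G.map (d.app X) ≫ d.app (G.obj X)

/-- A natural weak factorisation system on `C`. -/
structure NaturalWFS (C : Type u) [Category.{v} C] extends ComonadMonadFactorisation C where
  distributive : IsDistributiveLaw toComonadMonadFactorisation.comonadL
    toComonadMonadFactorisation.monadR toComonadMonadFactorisation.exchange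

/-- A structure of `G`-coalgebra on a given object `X`. -/
structure CoalgebraOn {D : Type*} [Category* D] (G : Comonad D) (X : D) where
  a : X ⟶ G.obj X
  counit : a ≫ G.ε.app X = 𝟙 X
  coassoc : a ≫ G.δ.app X = a ≫ G.map a

namespace NaturalWFS

variable {C : Type u} [Category.{v} C]

/-- The natural w.f.s. `N` is an algebraic realisation of the w.f.s. whose left class is `W₁`
and whose right class is `W₂`: its factorisations are `(W₁, W₂)`-factorisations. -/
structure Realises (N : NaturalWFS C) (W₁ W₂ : MorphismProperty C) : Prop where
  lam_mem : ∀ f : Arrow C, W₁ (N.lam.app f)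
  rho_mem : ∀ f : Arrow C, W₂ (N.rho.app f)

/-- A morphism of natural w.f.s.: a natural family `app f : P f ⟶ P' f` commuting with the two
parts of the factorisations, such that `(1, app f) : lam f ⟶ lam' f` is a morphism of comonads
and `(app f, 1) : rho f ⟶ rho' f` is a morphism of monads. (Compatibility with the counits and
the units is automatic.) -/
structure Hom (N N' : NaturalWFS C) extends NatTrans N.P N'.P where
  lam_app : ∀ f : Arrow C, N.lam.app f ≫ app f = N'.lam.app f
  app_rho : ∀ f : Arrow C, app f ≫ N'.rho.app f = N.rho.app f
  app_sigma : ∀ f : Arrow C, app f ≫ N'.sigma.app f =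
    N.sigma.app f ≫ app (N.L.obj f) ≫
      N'.P.map (Arrow.homMk (𝟙 _) (app f)
        ((Category.id_comp _).trans (lam_app f).symm) : N.L.obj f ⟶ N'.L.obj f)
  pi_app : ∀ f : Arrow C, N.pi.app f ≫ app f =
    (N.P.map (Arrow.homMk (app f) (𝟙 _)
        ((app_rho f).trans (Category.comp_id _).symm) : N.R.obj f ⟶ N'.R.obj f) ≫
      app (N'.R.obj f)) ≫ N'.pi.app f

namespace Hom

variable {N N' : NaturalWFS C} (K : Hom N N')

/-- The morphism of comonads `L ⟶ L'` underlying a morphism of natural w.f.s. -/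
def comonadHom : ComonadHom N.comonadL N'.comonadL where
  app f := Arrow.homMk (𝟙 _) (K.app f) ((Category.id_comp _).trans (K.lam_app f).symm)
  naturality f g t := by
    ext
    · exact (Category.comp_id _).trans (Category.id_comp _).symm
    · exact K.naturality t
  app_ε f := by
    ext
    · exact Category.id_comp _
    · exact K.app_rho f
  app_δ f := by
    ext
    · exact congrArg (fun x => 𝟙 _ ≫ x) (Category.id_comp (𝟙 _)).symm
    · exact K.app_sigma f

/-- The morphism of monads `R ⟶ R'` underlying a morphism of natural w.f.s. -/
def monadHom : MonadHom N.monadR N'.monadR where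
  app f := Arrow.homMk (K.app f) (𝟙 _) ((K.app_rho f).trans (Category.comp_id _).symm)
  naturality f g t := by
    ext
    · exact K.naturality t
    · exact (Category.comp_id _).trans (Category.id_comp _).symm
  app_η f := by
    ext
    · exact K.lam_app f
    · exact Category.id_comp _
  app_μ f := by
    ext
    · exact K.pi_app f
    · exact (Category.comp_id _).symm

end Hom

/-- A distinguished structure of `L`-coalgebra on each map of `J`. -/
abbrev Coalgebras (N : NaturalWFS C) (J : MorphismProperty C) :=
  ∀ ⦃A B : C⦄ (j : A ⟶ B), J j → CoalgebraOn N.comonadL (Arrow.mk j)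

/-- The natural w.f.s. `N` with distinguished coalgebra structures `c` is the universal algebraic
realisation of `J`: it realises the w.f.s. cofibrantly generated by `J`, and it is free on the
requirement that the maps of `J` be equipped with coalgebra structures. -/
structure IsUniversalRealisation (J : MorphismProperty C) (N : NaturalWFS C)
    (c : N.Coalgebras J) : Prop where
  realises : N.Realises J.rlp.llp J.rlp
  free : ∀ (N' : NaturalWFS C) (c' : N'.Coalgebras J), ∃! K : Hom N N',
    ∀ ⦃A B : C⦄ (j : A ⟶ B) (hj : J j), (c j hj).a ≫ K.comonadHom.app (Arrow.mk j) = (c' j hj).a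

section CofibrantReplacement

variable [HasInitial C]

variable (C) in
/-- The isomorphism of `C` with the coslice under `0`, regarded as a functor `X ↦ (0 ⟶ X)`. -/
noncomputable def fromInitial : C ⥤ Arrow C where
  obj X := Arrow.mk (initial.to X)
  map f := Arrow.homMk (𝟙 _) f (initial.hom_ext _ _)
  map_id X := rfl
  map_comp f g := by
    ext
    · exact (Category.id_comp _).symm
    · rfl

/-- The arrow `lam (0 ⟶ X)` is the unique map from `0` to its codomain. -/
noncomputable def toFromInitial (N : NaturalWFS C) (X : C) :
    N.L.obj ((fromInitial C).obj X) ⟶ (fromInitial C).obj (N.P.obj ((fromInitial C).obj X)) :=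
  Arrow.homMk (𝟙 _) (𝟙 _) (initial.hom_ext _ _)

lemma fromInitial_hom_ext {X : C} {f : ⊥_ C ⟶ X} {g : Arrow C} (s t : Arrow.mk f ⟶ g)
    (w : s.right = t.right) : s = t := by
  ext
  · exact initial.hom_ext (C := C) _ _
  · exact w

/-- The restriction of the comonad `L` of a natural w.f.s. to the coslice under `0`, regarded as
a comonad on `C`: it sends `X` to the middle object `Q X` of the factorisation
`0 ⟶ Q X ⟶ X`, and its counit at `X` is the right part `Q X ⟶ X` of that factorisation. -/
noncomputable def cofibrantReplacement (N : NaturalWFS C) : Comonad C where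
  toFunctor := fromInitial C ⋙ N.P
  ε :=
    { app := fun X => N.rho.app ((fromInitial C).obj X)
      naturality := fun X Y f => N.rho.naturality ((fromInitial C).map f) }
  δ :=
    { app := fun X => N.sigma.app ((fromInitial C).obj X) ≫ N.P.map (N.toFromInitial X)
      naturality := fun X Y f => by
        have h := N.sigma.naturality ((fromInitial C).map f)
        have e : N.L.map ((fromInitial C).map f) ≫ N.toFromInitial Y =
            N.toFromInitial X ≫ (fromInitial C).map (N.P.map ((fromInitial C).map f)) :=
          fromInitial_hom_ext _ _ ((Category.comp_id _).trans (Category.id_comp _).symm)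
        have e' := congrArg N.P.map e
        rw [N.P.map_comp, N.P.map_comp] at e'
        dsimp only [Functor.comp_map, Functor.comp_obj] at h ⊢
        rw [reassoc_of% h, e', Category.assoc] }
  coassoc X := by
    have n := N.sigma.naturality (N.toFromInitial X)
    have h := N.sigma_coassoc ((fromInitial C).obj X)
    dsimp only [Functor.comp_map, Functor.comp_obj] at h n ⊢
    rw [Category.assoc, Category.assoc, reassoc_of% n, ← reassoc_of% h]
    simp only [← N.P.map_comp]
    congr 2
    refine fromInitial_hom_ext _ _ ?_
    exact (Category.id_comp _).trans (congrArg (fun x => N.sigma.app _ ≫ x)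
      (Category.comp_id _).symm)
  left_counit X := by
    have h := N.sigma_rho ((fromInitial C).obj X)
    have n := N.rho.naturality (N.toFromInitial X)
    exact (Category.assoc _ _ _).trans ((congrArg (fun x => N.sigma.app _ ≫ x) n).trans
      ((Category.assoc _ _ _).symm.trans
        ((congrArg (fun x => x ≫ 𝟙 _) h).trans (Category.comp_id _))))
  right_counit X := by
    have h := N.sigma_map_counit ((fromInitial C).obj X)
    have e : N.toFromInitial X ≫ (fromInitial C).map (N.rho.app ((fromInitial C).obj X)) =
        N.counitL.app ((fromInitial C).obj X) :=
      fromInitial_hom_ext _ _ (Category.id_comp _)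
    exact (Category.assoc _ _ _).trans ((congrArg (fun x => N.sigma.app _ ≫ x)
      ((N.P.map_comp _ _).symm.trans (congrArg N.P.map e))).trans h)

end CofibrantReplacement

end NaturalWFS

section AlgebraicAcyclicFibrations

variable {C : Type u} [Category.{v} C]

/-- A choice of liftings for `f` with respect to `J`. -/
structure ChoiceOfLiftings (J : MorphismProperty C) {Y X : C} (f : Y ⟶ X) where
  lift : ∀ {A B : C} (j : A ⟶ B) (_ : J j) (h : A ⟶ Y) (k : B ⟶ X) (_ : h ≫ f = j ≫ k), B ⟶ Y
  comp_lift : ∀ {A B : C} (j : A ⟶ B) (hj : J j) (h : A ⟶ Y) (k : B ⟶ X) (w : h ≫ f = j ≫ k),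
    j ≫ lift j hj h k w = h
  lift_comp : ∀ {A B : C} (j : A ⟶ B) (hj : J j) (h : A ⟶ Y) (k : B ⟶ X) (w : h ≫ f = j ≫ k),
    lift j hj h k w ≫ f = k

/-- An algebraic acyclic fibration into `X`, with respect to `J`. -/
structure AAF (J : MorphismProperty C) (X : C) where
  {dom : C}
  map : dom ⟶ X
  lifting : ChoiceOfLiftings J map

namespace AAF

variable {J : MorphismProperty C} {X : C}

/-- A morphism of algebraic acyclic fibrations into `X`: a commutative triangle over `X` whose
upper side preserves the chosen liftings. -/
@[ext]
structure Hom (p q : AAF J X) where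
  u : p.dom ⟶ q.dom
  w : u ≫ q.map = p.map
  lift_u : ∀ {A B : C} (j : A ⟶ B) (hj : J j) (h : A ⟶ p.dom) (k : B ⟶ X)
    (sq : h ≫ p.map = j ≫ k),
    p.lifting.lift j hj h k sq ≫ u =
      q.lifting.lift j hj (h ≫ u) k (by rw [Category.assoc, w, sq])

/-- The category of algebraic acyclic fibrations into `X`. -/
instance : Category (AAF J X) where
  Hom := Hom
  id p := { u := 𝟙 _, w := by simp, lift_u := by simp }
  comp a b :=
    { u := a.u ≫ b.u
      w := by rw [Category.assoc, b.w, a.w]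
      lift_u := fun j hj h k sq => by
        rw [← Category.assoc, a.lift_u, b.lift_u]
        congr 1
        rw [Category.assoc] }
  id_comp a := by ext; simp
  comp_id a := by ext; simp
  assoc a b c := by ext; simp

end AAF

end AlgebraicAcyclicFibrations

end AlgebraicWFS

/-! Everything follows from the existence of free arrows with chosen liftings. Mark squares from
maps of `J` to an arrow `g` by naming fillers. An arrow with a choice of liftings is then a marked
arrow in which each square carries exactly one mark, and this is orthogonality to a small set of
maps between presentable objects. The orthogonal subcategory is reflective
(`MarkedArrow.exists_reflection`), so every arrow `f` has a free arrow with chosen liftings.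
Identities have only one choice of liftings, so the reflection leaves the codomain fixed up to
isomorphism and yields a factorisation of `f` with free right part (`nonempty_freeFactorisation`).

Freeness means that a lifting-preserving map out of `P f`, over a given map of codomains, is
determined by its composite with `lam`. Choices of liftings compose, so `sigma` is the extension of
`lam (lam f)` to the composite choice on `rho (lam f) ≫ rho f`, and `pi` is the extension of the
identity. All axioms, the distributive law included, hold because both sides preserve liftings and
agree on `lam`.

Conversely, coalgebra structures on `J` for any natural w.f.s. induce liftings on all its right
parts, preserved by `P t`, `pi` and `sigma`; the last uses the distributive law (`liftMap_s`).
Freeness then gives exactly one morphism from the free system. Any universal realisation maps to the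
free one and back, with identity composite, so its right parts are free too. At `0 ⟶ X`, freeness
over `X` is initiality in `AAF J X`. -/

namespace AlgebraicWFS

open Opposite

/-! ### Presentability of families of objects and of arrows. -/

section Presentability

/-- A small family of objects of a locally presentable category is uniformly presentable. -/
lemma exists_isCardinalPresentable_family {C : Type u} [Category.{v} C] [IsLocallyPresentable.{v} C]
    {ι : Type v} (A : ι → C) :
    ∃ (κ : Cardinal.{v}) (_ : Fact κ.IsRegular), ∀ i, IsCardinalPresentable (A i) κ := by
  choose κ hκ hA using fun i ↦ (inferInstance : IsPresentable.{v} (A i)).exists_cardinal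
  -- A supremum of regular cardinals need not be regular, but the successor of an infinite cardinal
  -- is.
  let κ' : Cardinal.{v} := Order.succ (Cardinal.aleph0 ⊔ iSup κ)
  have : Fact κ'.IsRegular := ⟨Cardinal.isRegular_succ le_sup_left⟩
  refine ⟨κ', this, fun i ↦ ?_⟩
  have := hκ i
  have : IsCardinalPresentable (A i) (κ i) := hA i
  exact isCardinalPresentable_of_le (A i)
    ((le_ciSup (Cardinal.bddAbove_of_small) i).trans (le_sup_right.trans (Order.le_succ _)))

/-- An arrow between presentable objects is presentable in the arrow category. -/
lemma isCardinalPresentable_arrow {C : Type u} [Category.{v} C] [HasColimitsOfSize.{v, v} C]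
    (κ : Cardinal.{v}) [Fact κ.IsRegular] (f : Arrow C)
    [IsCardinalPresentable f.left κ] [IsCardinalPresentable f.right κ] :
    IsCardinalPresentable f κ where
  preservesColimitOfShape K _ _ := ⟨fun {F} ↦ ⟨fun {c} hc ↦ ⟨by
    have := isFiltered_of_isCardinalFiltered K κ
    have hl := isColimitOfPreserves Arrow.leftFunc hc
    have hr := isColimitOfPreserves Arrow.rightFunc hc
    apply Types.FilteredColimit.isColimitOf'
    · intro (t : f ⟶ c.pt)
      obtain ⟨k₁, a, ha⟩ : ∃ (k : K) (a : f.left ⟶ (F.obj k).left), a ≫ (c.ι.app k).left = t.left :=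
        IsCardinalPresentable.exists_hom_of_isColimit κ hl t.left
      obtain ⟨k₂, b, hb⟩ :
          ∃ (k : K) (b : f.right ⟶ (F.obj k).right), b ≫ (c.ι.app k).right = t.right :=
        IsCardinalPresentable.exists_hom_of_isColimit κ hr t.right
      -- The factorisations of the two ends form a commutative square only in the colimit.
      -- Presentability of `f.left` makes it commute at a later stage.
      obtain ⟨k, p, q, e⟩ : ∃ (k : K) (p : k₁ ⟶ k) (q : k₂ ⟶ k),
          (a ≫ (F.obj k₁).hom) ≫ (F.map p).right = (f.hom ≫ b) ≫ (F.map q).right :=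
        IsCardinalPresentable.exists_eq_of_isColimit κ hr _ _ (by
          change (a ≫ (F.obj k₁).hom) ≫ (c.ι.app k₁).right = (f.hom ≫ b) ≫ (c.ι.app k₂).right
          have h₁ : (c.ι.app k₁).left ≫ c.pt.hom = (F.obj k₁).hom ≫ (c.ι.app k₁).right :=
            Arrow.w (c.ι.app k₁)
          rw [Category.assoc, Category.assoc, hb, ← h₁, reassoc_of% ha]
          exact Arrow.w t)
      refine ⟨k, Arrow.homMk (a ≫ (F.map p).left) (b ≫ (F.map q).right) ?_, ?_⟩
      · have h₁ := Arrow.w (F.map p)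
        rw [Category.assoc, h₁, ← Category.assoc, e, Category.assoc]
      · have h₁ : (F.map p).left ≫ (c.ι.app k).left = (c.ι.app k₁).left :=
          congrArg Arrow.Hom.left (c.w p)
        have h₂ : (F.map q).right ≫ (c.ι.app k).right = (c.ι.app k₂).right :=
          congrArg Arrow.Hom.right (c.w q)
        change t = Arrow.homMk _ _ _ ≫ c.ι.app k
        ext
        · exact ha.symm.trans (by rw [← h₁]; exact (Category.assoc _ _ _).symm)
        · exact hb.symm.trans (by rw [← h₂]; exact (Category.assoc _ _ _).symm)
    · intro k (s : f ⟶ F.obj k) (t : f ⟶ F.obj k) (e : s ≫ c.ι.app k = t ≫ c.ι.app k)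
      obtain ⟨k₁, p, hp⟩ : ∃ (k' : K) (p : k ⟶ k'),
          s.left ≫ (F.map p).left = t.left ≫ (F.map p).left :=
        IsCardinalPresentable.exists_eq_of_isColimit' κ hl s.left t.left
          (congrArg Arrow.Hom.left e)
      obtain ⟨k₂, q, hq⟩ : ∃ (k' : K) (q : k ⟶ k'),
          s.right ≫ (F.map q).right = t.right ≫ (F.map q).right :=
        IsCardinalPresentable.exists_eq_of_isColimit' κ hr s.right t.right
          (congrArg Arrow.Hom.right e)
      obtain ⟨l, p', q', e'⟩ := IsFiltered.span p q
      refine ⟨l, p ≫ p', ?_⟩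
      change s ≫ F.map _ = t ≫ F.map _
      ext
      · simp [reassoc_of% hp]
      · rw [e']
        simp [reassoc_of% hq]⟩⟩⟩

end Presentability

/-! ### Marked arrows and the orthogonality that makes markings into choices of liftings. -/

section MarkedArrows

variable {C : Type u} [Category.{v} C] {ι : Type v} (j : ι → Arrow C)

/-- The functor sending an arrow `g` to the family of sets of maps from the codomains of the
`j i` to the domain of `g`. -/
abbrev fillers : Arrow C ⥤ Discrete ι ⥤ Type v :=
  Arrow.leftFunc ⋙ (Discrete.functor (fun i ↦ op (j i).right) ⋙ coyoneda).flip

/-- Arrows `g` with a family of sets `S i` whose elements mark squares from `j i` to `g` with a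
diagonal filler. -/
abbrev MarkedArrow := Comma (𝟭 (Discrete ι ⥤ Type v)) (fillers j)

namespace MarkedArrow

variable {j}

/-- The filler of a marked square. -/
def filler (M : MarkedArrow j) {i : ι} (s : M.left.obj ⟨i⟩) : (j i).right ⟶ M.right.left :=
  M.hom.app ⟨i⟩ s

/-- A marked square. -/
def square (M : MarkedArrow j) {i : ι} (s : M.left.obj ⟨i⟩) : j i ⟶ M.right :=
  Arrow.homMk ((j i).hom ≫ M.filler s) (M.filler s ≫ M.right.hom) (Category.assoc _ _ _)

lemma filler_map {M N : MarkedArrow j} (t : M ⟶ N) {i : ι} (s : M.left.obj ⟨i⟩) :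
    N.filler (t.left.app ⟨i⟩ s) = M.filler s ≫ t.right.left :=
  congrArg (fun a ↦ a.app ⟨i⟩ s) t.w

lemma square_map {M N : MarkedArrow j} (t : M ⟶ N) {i : ι} (s : M.left.obj ⟨i⟩) :
    N.square (t.left.app ⟨i⟩ s) = M.square s ≫ t.right := by
  have w : t.right.left ≫ N.right.hom = M.right.hom ≫ t.right.right := Arrow.w t.right
  ext
  · change _ ≫ N.filler _ = (_ ≫ _) ≫ _
    rw [filler_map, Category.assoc]
  · change N.filler _ ≫ _ = (_ ≫ _) ≫ _
    rw [filler_map, Category.assoc, Category.assoc, w]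

variable (j)

/-- An arrow with no marked squares. -/
noncomputable def unmarked (f : Arrow C) : MarkedArrow j where
  left := (Functor.const _).obj PEmpty
  right := f
  hom := { app := fun _ ↦ ↾ PEmpty.elim, naturality := fun _ _ _ ↦ by ext x; exact x.elim }

/-- Maps out of an arrow with no marked squares. -/
noncomputable def unmarkedEquiv (f : Arrow C) (M : MarkedArrow j) :
    (unmarked j f ⟶ M) ≃ (f ⟶ M.right) where
  toFun t := t.right
  invFun t :=
    { left := { app := fun _ ↦ ↾ PEmpty.elim, naturality := fun _ _ _ ↦ by ext x; exact x.elim }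
      right := t
      w := by ext _ x; exact x.elim }
  left_inv t := by
    ext _ x
    · exact x.elim
    · rfl
    · rfl
  right_inv t := rfl

/-- The walking marked square with side `j i`. -/
def walking (i : ι) : MarkedArrow j where
  left := coyoneda.obj (op ⟨i⟩)
  right := Arrow.mk (𝟙 (j i).right)
  hom := coyonedaEquiv.symm (𝟙 (j i).right)

lemma filler_walking (i : ι) : (walking j i).filler (𝟙 (Discrete.mk i)) = 𝟙 _ :=
  Functor.map_id_apply ((fillers j).obj (Arrow.mk (𝟙 (j i).right))) _ _

/-- Maps out of the walking marked square. -/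
def walkingEquiv (i : ι) (M : MarkedArrow j) : (walking j i ⟶ M) ≃ M.left.obj ⟨i⟩ where
  toFun t := t.left.app ⟨i⟩ (𝟙 _)
  invFun s :=
    { left := coyonedaEquiv.symm s
      right := Arrow.homMk (M.filler s) (M.filler s ≫ M.right.hom) (Category.id_comp _).symm
      w := by
        apply coyonedaEquiv.injective
        change M.hom.app ⟨i⟩ (coyonedaEquiv (coyonedaEquiv.symm s)) =
          (walking j i).filler (𝟙 (Discrete.mk i)) ≫ M.filler s
        rw [Equiv.apply_symm_apply, filler_walking]
        exact (Category.id_comp _).symm }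
  left_inv t := by
    have h : M.filler (t.left.app ⟨i⟩ (𝟙 (Discrete.mk i))) = t.right.left :=
      (filler_map t (i := i) (𝟙 (Discrete.mk i))).trans
        ((congrArg (· ≫ t.right.left) (filler_walking j i)).trans (Category.id_comp _))
    apply CommaMorphism.ext
    · exact coyonedaEquiv.symm_apply_apply _
    · ext
      · exact h
      · have w : t.right.left ≫ M.right.hom = 𝟙 _ ≫ t.right.right := Arrow.w t.right
        rw [← h, Category.id_comp] at w
        exact w
  right_inv s := coyonedaEquiv.apply_symm_apply _

/-- The map of marked arrows inducing a filler. -/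
noncomputable def mark (i : ι) : unmarked j (j i) ⟶ walking j i :=
  (unmarkedEquiv j _ _).symm (Arrow.homMk (j i).hom (𝟙 _) rfl)

lemma unmarkedEquiv_mark (i : ι) (M : MarkedArrow j) (t : walking j i ⟶ M) :
    unmarkedEquiv j _ _ (mark j i ≫ t) = M.square (walkingEquiv j i M t) := by
  obtain ⟨s, rfl⟩ := (walkingEquiv j i M).symm.surjective t
  rw [Equiv.apply_symm_apply]
  ext
  · rfl
  · exact Category.id_comp _

/-- The maps with respect to which the local objects are the algebraic acyclic fibrations. -/
abbrev marks : MorphismProperty (MarkedArrow j) := MorphismProperty.ofHoms (mark j)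

/-- Maps from `walking j i` are marks and maps from `unmarked j (j i)` are squares; under these
identifications precomposition with `mark j i` is `square`. -/
lemma isLocal_marks_iff (M : MarkedArrow j) :
    (marks j).isLocal M ↔ ∀ i, Function.Bijective (M.square (i := i)) := by
  have key (i : ι) : Function.Bijective (fun t : walking j i ⟶ M ↦ mark j i ≫ t) ↔
      Function.Bijective (M.square (i := i)) := by
    rw [← (unmarkedEquiv j (j i) M).comp_bijective, ← (walkingEquiv j i M).symm.bijective_comp]
    apply iff_of_eq
    congr 1
    ext1 s
    exact (unmarkedEquiv_mark j i M _).trans (by rw [Equiv.apply_symm_apply])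
  refine ⟨fun h i ↦ (key i).1 (h _ ⟨i⟩), ?_⟩
  rintro h _ _ _ ⟨i⟩
  exact (key i).2 (h i)

section

variable [HasColimitsOfSize.{v, v} C] (κ : Cardinal.{v}) [Fact κ.IsRegular]

/-- The functor corepresented is `Comma.snd` followed by maps out of `f`, and both are accessible.
-/
lemma isCardinalPresentable_unmarked (f : Arrow C) [IsCardinalPresentable f κ] :
    IsCardinalPresentable (unmarked j f) κ :=
  have : (Comma.snd (𝟭 (Discrete ι ⥤ Type v)) (fillers j)).IsCardinalAccessible κ :=
    ⟨fun _ _ _ ↦ inferInstance⟩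
  have : (coyoneda.obj (op f)).IsCardinalAccessible κ := ‹IsCardinalPresentable f κ›
  Functor.isCardinalAccessible_of_natIso (F := Comma.snd _ _ ⋙ coyoneda.obj (op f))
    (G := coyoneda.obj (op (unmarked j f))) (NatIso.ofComponents (fun M ↦ (unmarkedEquiv j f M).symm.toIso) (fun {M N} t ↦ by
      ext s
      apply (unmarkedEquiv j f N).injective
      exact Equiv.apply_symm_apply _ _)) κ

lemma isCardinalPresentable_walking (i : ι) : IsCardinalPresentable (walking j i) κ :=
  have : (Comma.fst (𝟭 (Discrete ι ⥤ Type v)) (fillers j)).IsCardinalAccessible κ :=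
    ⟨fun _ _ _ ↦ inferInstance⟩
  have : ((evaluation (Discrete ι) (Type v)).obj ⟨i⟩).IsCardinalAccessible κ :=
    ⟨fun _ _ _ ↦ inferInstance⟩
  Functor.isCardinalAccessible_of_natIso
    (F := Comma.fst _ _ ⋙ (evaluation (Discrete ι) (Type v)).obj ⟨i⟩)
    (G := coyoneda.obj (op (walking j i))) (NatIso.ofComponents (fun M ↦ (walkingEquiv j i M).symm.toIso) (fun {M N} t ↦ by
      ext s
      apply (walkingEquiv j i N).injective
      refine (Equiv.apply_symm_apply _ _).trans ?_
      exact congrArg (t.left.app ⟨i⟩) ((walkingEquiv j i M).apply_symm_apply s).symm)) κ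

end

/-- The orthogonal reflection theorem for `marks j`. Reflecting `f` with no marks imposes no
condition beyond a map from `f`, hence freeness on `f` alone. -/
lemma exists_reflection [IsLocallyPresentable.{v} C] [HasColimitsOfSize.{v, v} C] (f : Arrow C) :
    ∃ (M : MarkedArrow j) (_ : ∀ i, Function.Bijective (M.square (i := i))) (η : f ⟶ M.right),
      ∀ (N : MarkedArrow j), (∀ i, Function.Bijective (N.square (i := i))) → ∀ t : f ⟶ N.right,
        ∃! s : M ⟶ N, η ≫ s.right = t := by
  -- The index `ι ⊕ ι` gives one cardinal for all domains and codomains together.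
  obtain ⟨κ, _, hκ⟩ := exists_isCardinalPresentable_family
    (fun i : ι ⊕ ι ↦ i.elim (fun i ↦ (j i).left) (fun i ↦ (j i).right))
  have := MorphismProperty.isRightAdjoint_ι_isLocal (marks j) κ (by
    rintro _ _ _ ⟨i⟩
    have : IsCardinalPresentable (j i).left κ := hκ (.inl i)
    have : IsCardinalPresentable (j i).right κ := hκ (.inr i)
    have := isCardinalPresentable_arrow κ (j i)
    exact ⟨isCardinalPresentable_unmarked j κ _, isCardinalPresentable_walking j κ i⟩)
  let adj := Adjunction.ofIsRightAdjoint (marks j).isLocal.ι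
  let M := (marks j).isLocal.ι.leftAdjoint.obj (unmarked j f)
  refine ⟨M.obj, (isLocal_marks_iff j _).1 M.property,
    unmarkedEquiv j f _ (adj.unit.app (unmarked j f)), fun N hN t ↦ ?_⟩
  let N' : (marks j).isLocal.FullSubcategory := ⟨N, (isLocal_marks_iff j _).2 hN⟩
  let e : (M ⟶ N') ≃ (f ⟶ N.right) :=
    (adj.homEquiv (unmarked j f) N').trans (unmarkedEquiv j f N)
  have he (s : M ⟶ N') :
      e s = unmarkedEquiv j f _ (adj.unit.app (unmarked j f)) ≫ s.hom.right := by
    dsimp only [e, Equiv.trans_apply]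
    rw [adj.homEquiv_unit]
    rfl
  refine ⟨(e.symm t).hom, (he _).symm.trans (e.apply_symm_apply t), fun s hs ↦ ?_⟩
  have : e ⟨s⟩ = t := (he _).trans hs
  rw [← this, Equiv.symm_apply_apply]

end MarkedArrow

end MarkedArrows

/-! ### Free arrows with chosen liftings, and free factorisations. -/

section FreeAlgebras

variable {C : Type u} [Category.{v} C] {J : MorphismProperty C}

namespace ChoiceOfLiftings

/-- A square from `f` to `g` preserves chosen liftings. -/
def Preserves {X Y Z W : C} {f : X ⟶ Y} {g : Z ⟶ W} (φ : ChoiceOfLiftings J f)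
    (ψ : ChoiceOfLiftings J g) (u : X ⟶ Z) (v : Y ⟶ W) : Prop :=
  ∀ ⦃A B : C⦄ (j : A ⟶ B) (hj : J j) (h : A ⟶ X) (k : B ⟶ Y) (w : h ≫ f = j ≫ k)
    (w' : (h ≫ u) ≫ g = j ≫ k ≫ v),
    φ.lift j hj h k w ≫ u = ψ.lift j hj (h ≫ u) (k ≫ v) w'

/-- The proof `w` depends on `h` and `k`, which obstructs rewriting inside a chosen lifting. -/
lemma lift_congr {X Y : C} {f : X ⟶ Y} (φ : ChoiceOfLiftings J f) {A B : C} (j : A ⟶ B) (hj : J j)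
    {h h' : A ⟶ X} {k k' : B ⟶ Y} (w : h ≫ f = j ≫ k) (w' : h' ≫ f = j ≫ k') (eh : h = h')
    (ek : k = k') : φ.lift j hj h k w = φ.lift j hj h' k' w' := by
  subst eh ek
  rfl

lemma Preserves.comp {X Y Z W S T : C} {f : X ⟶ Y} {g : Z ⟶ W} {e : S ⟶ T}
    {φ : ChoiceOfLiftings J f} {ψ : ChoiceOfLiftings J g} {χ : ChoiceOfLiftings J e}
    {u : X ⟶ Z} {v : Y ⟶ W} {u' : Z ⟶ S} {v' : W ⟶ T}
    (H : φ.Preserves ψ u v) (sq : u ≫ g = f ≫ v) (H' : ψ.Preserves χ u' v') :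
    φ.Preserves χ (u ≫ u') (v ≫ v') := by
  intro A B j hj h k w w'
  have w₁ : (h ≫ u) ≫ g = j ≫ k ≫ v := by rw [Category.assoc, sq, reassoc_of% w]
  rw [← Category.assoc, H j hj h k w w₁, H' j hj _ _ w₁ (by simpa using w')]
  exact lift_congr _ _ _ _ _ (Category.assoc _ _ _) (Category.assoc _ _ _)

lemma Preserves.id {X Y : C} {f : X ⟶ Y} (φ : ChoiceOfLiftings J f) :
    φ.Preserves φ (𝟙 X) (𝟙 Y) := by
  intro A B j hj h k w w'
  rw [Category.comp_id]
  exact lift_congr _ _ _ _ _ (Category.comp_id _).symm (Category.comp_id _).symm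

variable (J) in
/-- The only choice of liftings for an identity. -/
def identity (X : C) : ChoiceOfLiftings J (𝟙 X) where
  lift _ _ _ k _ := k
  comp_lift _ _ _ _ w := w.symm.trans (Category.comp_id _)
  lift_comp _ _ _ _ _ := Category.comp_id _

end ChoiceOfLiftings

section

variable {ι : Type v} {j : ι → Arrow C}

/-- The marked arrow whose marked squares are all squares, with their chosen fillers. -/
def ChoiceOfLiftings.toMarkedArrow (hj : ∀ i, J (j i).hom) {g : Arrow C}
    (ψ : ChoiceOfLiftings J g.hom) : MarkedArrow j where
  left := Discrete.functor (fun i ↦ (j i ⟶ g))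
  right := g
  hom := Discrete.natTrans (fun i ↦ ↾ fun t ↦
    ψ.lift (j i.as).hom (hj i.as) t.left t.right (Arrow.w t))

lemma ChoiceOfLiftings.square_toMarkedArrow (hj : ∀ i, J (j i).hom) {g : Arrow C}
    (ψ : ChoiceOfLiftings J g.hom) {i : ι} (t : j i ⟶ g) :
    (ψ.toMarkedArrow hj).square (i := i) t = t := by
  ext
  · exact ψ.comp_lift _ _ _ _ _
  · exact ψ.lift_comp _ _ _ _ _

/-- A marked arrow with exactly one mark on each square has a choice of liftings. -/
lemma MarkedArrow.exists_choiceOfLiftings (hJ : ∀ x : Arrow C, J x.hom → ∃ i, j i = x)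
    (hinj : Function.Injective j) (M : MarkedArrow j)
    (hM : ∀ i, Function.Bijective (M.square (i := i))) :
    ∃ φ : ChoiceOfLiftings J M.right.hom, ∀ (i : ι) (hi : J (j i).hom) (s : M.left.obj ⟨i⟩),
      φ.lift (j i).hom hi (M.square s).left (M.square s).right (Arrow.w (M.square s)) =
        M.filler s := by
  -- The filler is chosen per arrow `x`, not per index, since a choice of liftings is indexed by
  -- maps. Heterogeneous equality states its agreement with every index naming `x`; injectivity of
  -- `j` leaves only one.
  have H (x : Arrow C) (hx : J x.hom) (t : x ⟶ M.right) : ∃ b : x.right ⟶ M.right.left,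
      ∀ (i : ι) (s : M.left.obj ⟨i⟩), j i = x → HEq (M.square s) t → HEq b (M.filler s) := by
    obtain ⟨i, rfl⟩ := hJ x hx
    obtain ⟨s, rfl⟩ := (hM i).2 t
    refine ⟨M.filler s, fun i' s' e h ↦ ?_⟩
    obtain rfl := hinj e
    obtain rfl := (hM i').1 (eq_of_heq h)
    rfl
  choose L hL using H
  have hL' (i : ι) (hi : J (j i).hom) (s : M.left.obj ⟨i⟩) :
      L (j i) hi (M.square s) = M.filler s :=
    eq_of_heq (hL _ hi _ i s rfl HEq.rfl)
  have comp_L (x : Arrow C) (hx : J x.hom) (t : x ⟶ M.right) : x.hom ≫ L x hx t = t.left := by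
    obtain ⟨i, rfl⟩ := hJ x hx
    obtain ⟨s, rfl⟩ := (hM i).2 t
    rw [hL']
    rfl
  have L_comp (x : Arrow C) (hx : J x.hom) (t : x ⟶ M.right) :
      L x hx t ≫ M.right.hom = t.right := by
    obtain ⟨i, rfl⟩ := hJ x hx
    obtain ⟨s, rfl⟩ := (hM i).2 t
    rw [hL']
    rfl
  exact ⟨{  lift := fun f hf h k w ↦ L (Arrow.mk f) hf (Arrow.homMk h k w)
            comp_lift := fun f hf h k w ↦ comp_L (Arrow.mk f) hf (Arrow.homMk h k w)
            lift_comp := fun f hf h k w ↦ L_comp (Arrow.mk f) hf (Arrow.homMk h k w) }, hL'⟩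

end

/-- Every arrow has a reflection among the arrows with a choice of liftings. -/
lemma exists_free_arrow [IsLocallyPresentable.{v} C] [HasColimitsOfSize.{v, v} C]
    [MorphismProperty.IsSmall.{v} J] (f : Arrow C) :
    ∃ (g : Arrow C) (φ : ChoiceOfLiftings J g.hom) (η : f ⟶ g),
      ∀ (g' : Arrow C) (ψ : ChoiceOfLiftings J g'.hom) (t : f ⟶ g'),
        ∃! s : g ⟶ g', η ≫ s = t ∧ φ.Preserves ψ s.left s.right := by
  -- The indexing must be injective: a map listed twice would receive two independent fillers for
  -- each square.
  let j (i : Shrink.{v} J.toSet) : Arrow C := ((equivShrink _).symm i).1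
  have hj (i) : J (j i).hom := ((equivShrink _).symm i).2
  have hJ (x : Arrow C) (hx : J x.hom) : ∃ i, j i = x := ⟨equivShrink _ ⟨x, hx⟩, by simp [j]⟩
  have hinj : Function.Injective j := Subtype.val_injective.comp (equivShrink _).symm.injective
  obtain ⟨M, hM, η, H⟩ := MarkedArrow.exists_reflection j f
  obtain ⟨φ, hφ⟩ := M.exists_choiceOfLiftings hJ hinj hM
  refine ⟨M.right, φ, η, fun g' ψ t ↦ ?_⟩
  obtain ⟨s, hs, hs'⟩ := H (ψ.toMarkedArrow hj) (fun i ↦ by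
    have e : ((ψ.toMarkedArrow hj).square (i := i)) = (id : (j i ⟶ g') → _) :=
      funext (ψ.square_toMarkedArrow hj)
    rw [e]
    exact Function.bijective_id) t
  -- The marks of `ψ.toMarkedArrow hj` are the squares themselves, so the action on marks is forced;
  -- compatibility with fillers is preservation of liftings.
  have key (s : M.right ⟶ g') : φ.Preserves ψ s.left s.right ↔
      ∃ s' : M ⟶ ψ.toMarkedArrow hj, s'.right = s := by
    constructor
    · intro h
      refine ⟨{ left := Discrete.natTrans (fun i ↦ ↾ fun m ↦ M.square (i := i.as) m ≫ s)
                right := s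
                w := ?_ }, rfl⟩
      ext ⟨i⟩ m
      change ψ.lift _ _ _ _ _ = M.filler (i := i) m ≫ s.left
      rw [← hφ i (hj i) m, h]
      rfl
    · rintro ⟨s', rfl⟩ A B p hp h k w w'
      have h' (x : Arrow C) (hx : J x.hom) (t : x ⟶ M.right) :
          φ.lift x.hom hx t.left t.right (Arrow.w t) ≫ s'.right.left =
            ψ.lift x.hom hx (t ≫ s'.right).left (t ≫ s'.right).right (Arrow.w (t ≫ s'.right)) := by
        obtain ⟨i, rfl⟩ := hJ x hx
        obtain ⟨m, rfl⟩ := (hM i).2 t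
        have e : s'.left.app ⟨i⟩ m = M.square m ≫ s'.right :=
          (ψ.square_toMarkedArrow hj _).symm.trans (MarkedArrow.square_map s' m)
        rw [hφ, ← MarkedArrow.filler_map, ← e]
        rfl
      exact h' (Arrow.mk p) hp (Arrow.homMk h k w)
  refine ⟨s.right, ⟨hs, (key _).2 ⟨s, rfl⟩⟩, ?_⟩
  rintro s₂ ⟨h₁, h₂⟩
  obtain ⟨s₃, rfl⟩ := (key _).1 h₂
  rw [hs' s₃ h₁]

/-- A factorisation of `f` whose right part has a choice of liftings and is free as such. -/
structure FreeFactorisation (J : MorphismProperty C) (f : Arrow C) where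
  P : C
  lam : f.left ⟶ P
  rho : P ⟶ f.right
  fac : lam ≫ rho = f.hom
  lifting : ChoiceOfLiftings J rho
  existsUnique : ∀ ⦃Z W : C⦄ (g : Z ⟶ W) (ψ : ChoiceOfLiftings J g) (a : f.left ⟶ Z)
    (b : f.right ⟶ W), a ≫ g = f.hom ≫ b →
      ∃! u : P ⟶ Z, lam ≫ u = a ∧ u ≫ g = rho ≫ b ∧ lifting.Preserves ψ u b

/-- Every square into an identity preserves liftings, so `f` and its reflection `g` have the same
maps to identities. Hence `η.right` is invertible, with inverse `r.right`, and `g` can be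
transported to have codomain `f.right`. -/
lemma nonempty_freeFactorisation [IsLocallyPresentable.{v} C] [HasColimitsOfSize.{v, v} C]
    [MorphismProperty.IsSmall.{v} J] (f : Arrow C) : Nonempty (FreeFactorisation J f) := by
  obtain ⟨g, φ, η, H⟩ := exists_free_arrow (J := J) f
  obtain ⟨r, ⟨hr, -⟩, -⟩ := H (Arrow.mk (𝟙 f.right)) (.identity J f.right)
    (Arrow.homMk f.hom (𝟙 _) rfl)
  have hr₁ : η.right ≫ r.right = 𝟙 _ := congrArg Arrow.Hom.right hr
  have hr₂ : r.right ≫ η.right = 𝟙 _ := by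
    have P (v : g.right ⟶ g.right) :
        φ.Preserves (.identity J g.right) (g.hom ≫ v) v := by
      intro A B j hj h k w w'
      rw [← Category.assoc, φ.lift_comp]
      rfl
    -- Both squares to the identity of `g.right` extend the same square from `f`, so their codomain
    -- components agree.
    have := (H (Arrow.mk (𝟙 g.right)) (.identity J g.right)
      (Arrow.homMk (f.hom ≫ η.right) η.right (Category.comp_id _))).unique
      (y₁ := Arrow.homMk (g.hom ≫ r.right ≫ η.right) (r.right ≫ η.right) (Category.comp_id _))
      (y₂ := Arrow.homMk (g.hom ≫ 𝟙 _) (𝟙 _) (Category.comp_id _))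
      ⟨by
        ext
        · change η.left ≫ g.hom ≫ r.right ≫ η.right = _
          rw [Arrow.w_assoc, reassoc_of% hr₁]
          rfl
        · change η.right ≫ r.right ≫ η.right = _
          rw [reassoc_of% hr₁]
          rfl, P _⟩
      ⟨by
        ext
        · change η.left ≫ g.hom ≫ 𝟙 _ = _
          rw [Arrow.w_assoc, Category.comp_id]
          rfl
        · exact Category.comp_id _, P _⟩
    exact congrArg Arrow.Hom.right this
  refine ⟨{ P := g.left
            lam := η.left
            rho := g.hom ≫ r.right
            fac := by rw [Arrow.w_assoc, hr₁, Category.comp_id]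
            lifting :=
              { lift := fun j hj h k w ↦ φ.lift j hj h (k ≫ η.right) (by
                  rw [← reassoc_of% w, hr₂, Category.comp_id])
                comp_lift := fun j hj h k w ↦ φ.comp_lift _ _ _ _ _
                lift_comp := fun j hj h k w ↦ by
                  rw [← Category.assoc, φ.lift_comp, Category.assoc, hr₁, Category.comp_id] }
            existsUnique := fun Z W g' ψ a b w ↦ ?_ }⟩
  obtain ⟨s, ⟨hs, hs'⟩, hs''⟩ := H (Arrow.mk g') ψ (Arrow.homMk a b w)
  have hb : η.right ≫ s.right = b := congrArg Arrow.Hom.right hs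
  refine ⟨s.left, ⟨congrArg Arrow.Hom.left hs, ?_, ?_⟩, ?_⟩
  · rw [← hb, Category.assoc, reassoc_of% hr₂]
    exact Arrow.w s
  · intro A B j hj h k w₁ w₂
    dsimp only
    rw [hs']
    · exact ψ.lift_congr _ _ _ _ rfl (by rw [Category.assoc, hb])
    · refine w₂.trans ?_
      rw [Category.assoc, hb]
  · rintro u ⟨hu₁, hu₂, hu₃⟩
    refine congrArg Arrow.Hom.left (hs'' (Arrow.homMk u (r.right ≫ b) ?_) ⟨?_, ?_⟩)
    · exact hu₂.trans (Category.assoc _ _ _)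
    · ext
      · exact hu₁
      · change η.right ≫ r.right ≫ b = b
        rw [reassoc_of% hr₁]
    · intro A B j hj h k w₁ w₂
      have w₃ : h ≫ g.hom ≫ r.right = j ≫ k ≫ r.right := by rw [reassoc_of% w₁]
      have := hu₃ j hj h (k ≫ r.right) w₃ (by simpa using w₂)
      dsimp only at this
      refine Eq.trans ?_ (this.trans ?_)
      · congr 1
        exact φ.lift_congr _ _ _ _ rfl (by rw [Category.assoc, hr₂, Category.comp_id])
      · exact ψ.lift_congr _ _ _ _ rfl (Category.assoc _ _ _)

end FreeAlgebras

/-! ### Lifting-preserving squares and composition of choices of liftings. -/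

section LiftMaps

variable {C : Type u} [Category.{v} C] {J : MorphismProperty C}

namespace ChoiceOfLiftings

/-- A commutative square preserving chosen liftings. -/
structure LiftMap {X Y Z W : C} {f : X ⟶ Y} {g : Z ⟶ W} (φ : ChoiceOfLiftings J f)
    (ψ : ChoiceOfLiftings J g) (u : X ⟶ Z) (v : Y ⟶ W) : Prop where
  sq : u ≫ g = f ≫ v
  preserves : φ.Preserves ψ u v

namespace LiftMap

lemma id {X Y : C} {f : X ⟶ Y} (φ : ChoiceOfLiftings J f) : LiftMap φ φ (𝟙 X) (𝟙 Y) :=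
  ⟨by simp, .id φ⟩

lemma comp {X Y Z W S T : C} {f : X ⟶ Y} {g : Z ⟶ W} {e : S ⟶ T}
    {φ : ChoiceOfLiftings J f} {ψ : ChoiceOfLiftings J g} {χ : ChoiceOfLiftings J e}
    {u : X ⟶ Z} {v : Y ⟶ W} {u' : Z ⟶ S} {v' : W ⟶ T}
    (H : LiftMap φ ψ u v) (H' : LiftMap ψ χ u' v') : LiftMap φ χ (u ≫ u') (v ≫ v') :=
  ⟨by rw [Category.assoc, H'.sq, reassoc_of% H.sq], H.preserves.comp H.sq H'.preserves⟩

lemma comp_id {X Y Z S T : C} {f : X ⟶ Y} {g : Z ⟶ T} {e : S ⟶ T}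
    {φ : ChoiceOfLiftings J f} {ψ : ChoiceOfLiftings J g} {χ : ChoiceOfLiftings J e}
    {u : X ⟶ Z} {v : Y ⟶ T} {u' : Z ⟶ S}
    (H : LiftMap φ ψ u v) (H' : LiftMap ψ χ u' (𝟙 _)) : LiftMap φ χ (u ≫ u') v := by
  simpa using H.comp H'

lemma id_comp {X Y Z S T : C} {f : X ⟶ Y} {g : Z ⟶ Y} {e : S ⟶ T}
    {φ : ChoiceOfLiftings J f} {ψ : ChoiceOfLiftings J g} {χ : ChoiceOfLiftings J e}
    {u : X ⟶ Z} {v' : Y ⟶ T} {u' : Z ⟶ S}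
    (H : LiftMap φ ψ u (𝟙 _)) (H' : LiftMap ψ χ u' v') : LiftMap φ χ (u ≫ u') v' := by
  simpa using H.comp H'

end LiftMap

/-- The composite of two choices of liftings. -/
def comp {X Y Z : C} {f : X ⟶ Y} {g : Y ⟶ Z} (φ : ChoiceOfLiftings J f)
    (ψ : ChoiceOfLiftings J g) : ChoiceOfLiftings J (f ≫ g) where
  lift j hj h k w := φ.lift j hj h (ψ.lift j hj (h ≫ f) k (by rw [Category.assoc, w]))
    (ψ.comp_lift _ _ _ _ _).symm
  comp_lift _ _ _ _ _ := φ.comp_lift _ _ _ _ _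
  lift_comp _ _ _ _ _ := by rw [← Category.assoc, φ.lift_comp, ψ.lift_comp]

lemma LiftMap.comp_fst {X Y Z : C} {f : X ⟶ Y} {g : Y ⟶ Z} (φ : ChoiceOfLiftings J f)
    (ψ : ChoiceOfLiftings J g) : LiftMap (φ.comp ψ) ψ f (𝟙 Z) := by
  refine ⟨by simp, fun A B j hj h k w w' ↦ (φ.lift_comp _ _ _ _ _).trans ?_⟩
  exact ψ.lift_congr _ _ _ _ rfl (Category.comp_id _).symm

lemma LiftMap.comp_map {X Y Z X' Y' Z' : C} {f : X ⟶ Y} {g : Y ⟶ Z} {f' : X' ⟶ Y'} {g' : Y' ⟶ Z'}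
    {φ : ChoiceOfLiftings J f} {ψ : ChoiceOfLiftings J g} {φ' : ChoiceOfLiftings J f'}
    {ψ' : ChoiceOfLiftings J g'} {u : X ⟶ X'} {v : Y ⟶ Y'} {t : Z ⟶ Z'} (H : LiftMap φ φ' u v)
    (H' : LiftMap ψ ψ' v t) : LiftMap (φ.comp ψ) (φ'.comp ψ') u t := by
  refine ⟨by rw [reassoc_of% H.sq, H'.sq, Category.assoc], fun A B j hj h k w w' ↦ ?_⟩
  have w₁ : (h ≫ f) ≫ g = j ≫ k := by rw [Category.assoc, w]
  have w₂ : ((h ≫ f) ≫ v) ≫ g' = j ≫ k ≫ t := by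
    rw [Category.assoc, H'.sq, ← Category.assoc, w₁, Category.assoc]
  have e := H'.preserves j hj (h ≫ f) k w₁ w₂
  refine (H.preserves j hj h _ _ ?_).trans ?_
  · rw [e, ψ'.comp_lift, Category.assoc, Category.assoc, H.sq]
  · refine φ'.lift_congr _ _ _ _ rfl (e.trans (ψ'.lift_congr _ _ _ _ ?_ rfl))
    rw [Category.assoc, Category.assoc, H.sq]

/-- Here `H` lies over `g`; following its base by `ψ`-liftings reduces to the original problem
because `ψ.lift` composed with `g` is `k`. This yields the counit law `sigma_map_counit`. -/
lemma LiftMap.comp_of_snd {X Y Z S : C} {f : X ⟶ Y} {g : Y ⟶ Z} {e : S ⟶ Z}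
    {φ : ChoiceOfLiftings J f} (ψ : ChoiceOfLiftings J g) {χ : ChoiceOfLiftings J e} {u : X ⟶ S}
    (H : LiftMap φ χ u g) : LiftMap (φ.comp ψ) χ u (𝟙 Z) := by
  refine ⟨by simp [H.sq], fun A B j hj h k w w' ↦ (H.preserves j hj h _ _ ?_).trans ?_⟩
  · rw [ψ.lift_comp, w', Category.comp_id]
  · exact χ.lift_congr _ _ _ _ rfl ((ψ.lift_comp _ _ _ _ _).trans (Category.comp_id _).symm)

/-- The two bracketings are choices for different expressions of the same map, so associativity is
stated by transferring lifting-preserving squares. -/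
lemma LiftMap.comp_assoc {X Y Z W S T : C} {f : X ⟶ Y} {g : Y ⟶ Z} {e : Z ⟶ W} {d : S ⟶ T}
    {φ : ChoiceOfLiftings J f} {ψ : ChoiceOfLiftings J g} {χ : ChoiceOfLiftings J e}
    {ω : ChoiceOfLiftings J d} {u : S ⟶ X} {v : T ⟶ W} (H : LiftMap ω (φ.comp (ψ.comp χ)) u v) :
    LiftMap ω ((φ.comp ψ).comp χ) u v :=
  ⟨by simpa using H.sq, fun A B j hj h k w w' ↦ H.preserves j hj h k w (by simpa using w')
    |>.trans (φ.lift_congr _ _ _ _ rfl (ψ.lift_congr _ _ _ _ rfl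
      (χ.lift_congr _ _ _ _ (Category.assoc _ _ _) rfl)))⟩

end ChoiceOfLiftings

open ChoiceOfLiftings

namespace FreeFactorisation

variable {f : Arrow C} (F : FreeFactorisation J f)

/-- The extension of a square along the left part of a free factorisation. -/
noncomputable def desc {Z W : C} {g : Z ⟶ W} (ψ : ChoiceOfLiftings J g) (a : f.left ⟶ Z)
    (b : f.right ⟶ W) (w : a ≫ g = f.hom ≫ b) : F.P ⟶ Z :=
  (F.existsUnique g ψ a b w).choose

section

variable {Z W : C} {g : Z ⟶ W} (ψ : ChoiceOfLiftings J g) (a : f.left ⟶ Z)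
    (b : f.right ⟶ W) (w : a ≫ g = f.hom ≫ b)

@[simp]
lemma lam_desc : F.lam ≫ F.desc ψ a b w = a := (F.existsUnique g ψ a b w).choose_spec.1.1

lemma liftMap_desc : LiftMap F.lifting ψ (F.desc ψ a b w) b :=
  ⟨(F.existsUnique g ψ a b w).choose_spec.1.2.1, (F.existsUnique g ψ a b w).choose_spec.1.2.2⟩

end

/-- The uniqueness half of freeness, and the source of every axiom of the free system. -/
lemma hom_ext {Z W : C} {g : Z ⟶ W} {ψ : ChoiceOfLiftings J g} {b : f.right ⟶ W} {u u' : F.P ⟶ Z}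
    (h : LiftMap F.lifting ψ u b) (h' : LiftMap F.lifting ψ u' b) (e : F.lam ≫ u = F.lam ≫ u') :
    u = u' :=
  (F.existsUnique g ψ (F.lam ≫ u) b (by rw [Category.assoc, h.sq, reassoc_of% F.fac])).unique
    ⟨rfl, h.sq, h.preserves⟩ ⟨e.symm, h'.sq, h'.preserves⟩

end FreeFactorisation

end LiftMaps

open ChoiceOfLiftings

/-! ### The natural w.f.s. of free factorisations. -/

section FreeNaturalWFS

variable {C : Type u} [Category.{v} C] {J : MorphismProperty C}
  (F : ∀ f : Arrow C, FreeFactorisation J f)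

/-- The action of the free factorisation on squares. -/
noncomputable def freeMap {f g : Arrow C} (t : f ⟶ g) : (F f).P ⟶ (F g).P :=
  (F f).desc (F g).lifting (t.left ≫ (F g).lam) t.right (by
    rw [Category.assoc, (F g).fac, Arrow.w])

lemma liftMap_freeMap {f g : Arrow C} (t : f ⟶ g) :
    LiftMap (F f).lifting (F g).lifting (freeMap F t) t.right :=
  (F f).liftMap_desc _ _ _ _

lemma lam_freeMap {f g : Arrow C} (t : f ⟶ g) :
    (F f).lam ≫ freeMap F t = t.left ≫ (F g).lam :=
  (F f).lam_desc _ _ _ _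

lemma lam_freeMap_assoc {f g : Arrow C} (t : f ⟶ g) {Z : C} (u : (F g).P ⟶ Z) :
    (F f).lam ≫ freeMap F t ≫ u = t.left ≫ (F g).lam ≫ u := by
  rw [← Category.assoc, lam_freeMap, Category.assoc]

/-- The functorial factorisation given by free factorisations. -/
noncomputable def freeFunctorialFactorisation : FunctorialFactorisation C where
  P :=
    { obj := fun f ↦ (F f).P
      map := freeMap F
      map_id := fun f ↦ (F f).hom_ext (liftMap_freeMap F _) (.id _) (by simp [lam_freeMap])
      map_comp := fun {f g h} s t ↦ (F f).hom_ext (liftMap_freeMap F _)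
        ((liftMap_freeMap F _).comp (liftMap_freeMap F _))
        (by simp [lam_freeMap, lam_freeMap_assoc]) }
  lam := { app := fun f ↦ (F f).lam, naturality := fun f g t ↦ (lam_freeMap F t).symm }
  rho := { app := fun f ↦ (F f).rho, naturality := fun f g t ↦ (liftMap_freeMap F t).sq }
  fac f := (F f).fac

/-- The left part of the free factorisation. -/
abbrev freeL (f : Arrow C) : Arrow C := Arrow.mk (F f).lam

/-- The right part of the free factorisation. -/
abbrev freeR (f : Arrow C) : Arrow C := Arrow.mk (F f).rho

/-- The composite of the choices of liftings of `rho (lam f)` and of `rho f`. -/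
abbrev freeComp (f : Arrow C) :
    ChoiceOfLiftings J ((F (freeL F f)).rho ≫ (F f).rho) :=
  (F (freeL F f)).lifting.comp (F f).lifting

/-- The comultiplication. -/
noncomputable def freeSigma (f : Arrow C) : (F f).P ⟶ (F (freeL F f)).P :=
  (F f).desc (freeComp F f) (F (freeL F f)).lam (𝟙 _) (by
    rw [← Category.assoc, Category.comp_id]
    exact (congrArg (· ≫ (F f).rho) (F (freeL F f)).fac).trans (F f).fac)

lemma liftMap_freeSigma (f : Arrow C) :
    LiftMap (F f).lifting (freeComp F f) (freeSigma F f) (𝟙 _) :=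
  (F f).liftMap_desc _ _ _ _

lemma lam_freeSigma (f : Arrow C) : (F f).lam ≫ freeSigma F f = (F (freeL F f)).lam :=
  (F f).lam_desc _ _ _ _

lemma lam_freeSigma_assoc (f : Arrow C) {Z : C} (u : (F (freeL F f)).P ⟶ Z) :
    (F f).lam ≫ freeSigma F f ≫ u = (F (freeL F f)).lam ≫ u := by
  rw [← lam_freeSigma]
  exact (Category.assoc _ _ _).symm

/-- The multiplication. -/
noncomputable def freePi (f : Arrow C) : (F (freeR F f)).P ⟶ (F f).P :=
  (F (freeR F f)).desc (F f).lifting (𝟙 (F f).P) (𝟙 _)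
    ((Category.id_comp _).trans (Category.comp_id _).symm)

lemma liftMap_freePi (f : Arrow C) :
    LiftMap (F (freeR F f)).lifting (F f).lifting (freePi F f) (𝟙 f.right) :=
  (F (freeR F f)).liftMap_desc _ _ _ _

lemma lam_freePi (f : Arrow C) : (F (freeR F f)).lam ≫ freePi F f = 𝟙 (F f).P :=
  (F (freeR F f)).lam_desc _ _ _ _

lemma lam_freePi_assoc (f : Arrow C) {Z : C} (u : (F f).P ⟶ Z) :
    (F (freeR F f)).lam ≫ freePi F f ≫ u = u := by
  refine (Category.assoc _ _ _).symm.trans ?_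
  rw [lam_freePi]
  exact Category.id_comp _

/-- The comonad and the monad given by free factorisations. -/
noncomputable def freeComonadMonadFactorisation : ComonadMonadFactorisation C where
  toFunctorialFactorisation := freeFunctorialFactorisation F
  sigma :=
    { app := fun f ↦ freeSigma F f
      naturality := fun f g t ↦ (F f).hom_ext
        ((liftMap_freeMap F t).comp_id (liftMap_freeSigma F g))
        ((liftMap_freeSigma F f).id_comp (.comp_map
          (liftMap_freeMap F ((freeFunctorialFactorisation F).L.map t))
          (liftMap_freeMap F t))) (by
          refine (lam_freeMap_assoc F _ _).trans ?_
          refine (congrArg (t.left ≫ ·) (lam_freeSigma F g)).trans ?_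
          exact ((lam_freeSigma_assoc F _ _).trans
            (lam_freeMap F ((freeFunctorialFactorisation F).L.map t))).symm) }
  pi :=
    { app := fun f ↦ freePi F f
      naturality := fun f g t ↦ (F (freeR F f)).hom_ext
        ((liftMap_freeMap F ((freeFunctorialFactorisation F).R.map t)).comp_id (liftMap_freePi F g))
        ((liftMap_freePi F f).id_comp (liftMap_freeMap F t)) (by
          refine (lam_freeMap_assoc F _ _).trans ?_
          refine (congrArg (freeMap F t ≫ ·) (lam_freePi F g)).trans ?_
          exact (Category.comp_id _).trans (lam_freePi_assoc F _ _).symm) }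
  lam_sigma := lam_freeSigma F
  pi_rho f := (liftMap_freePi F f).sq.trans (Category.comp_id _)
  sigma_rho f := (F f).hom_ext ((liftMap_freeSigma F f).comp_id (.comp_fst _ _)) (.id _)
    ((lam_freeSigma_assoc F _ _).trans ((F (freeL F f)).fac.trans (Category.comp_id _).symm))
  sigma_map_counit f := (F f).hom_ext ((liftMap_freeSigma F f).comp_id (.comp_of_snd _
      (liftMap_freeMap F ((freeFunctorialFactorisation F).counitL.app f)))) (.id _)
    ((lam_freeSigma_assoc F _ _).trans ((lam_freeMap F _).trans
      ((Category.id_comp _).trans (Category.comp_id _).symm)))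
  -- Both sides land in a composite of three choices, bracketed differently; `comp_assoc` reconciles
  -- them.
  sigma_coassoc f := (F f).hom_ext
    ((liftMap_freeSigma F f).comp_id (LiftMap.comp_map
      (liftMap_freeMap F _) (liftMap_freeSigma F f))).comp_assoc
    ((liftMap_freeSigma F f).comp_id (.comp_map (liftMap_freeSigma F _) (.id _)))
    ((lam_freeSigma_assoc F _ _).trans (((lam_freeMap F _).trans (Category.id_comp _)).trans
      ((lam_freeSigma_assoc F _ _).trans (lam_freeSigma F _)).symm))
  lam_pi := lam_freePi F
  map_unit_pi f := (F f).hom_ext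
    ((liftMap_freeMap F ((freeFunctorialFactorisation F).unitR.app f)).comp_id
      (liftMap_freePi F f)) (.id _)
    ((lam_freeMap_assoc F _ _).trans (congrArg ((F f).lam ≫ ·) (lam_freePi F f)))
  pi_assoc f := (F _).hom_ext
    ((liftMap_freeMap F _).comp_id (liftMap_freePi F f))
    ((liftMap_freePi F (freeR F f)).comp_id (liftMap_freePi F f))
    ((lam_freeMap_assoc F _ _).trans ((congrArg (freePi F f ≫ ·) (lam_freePi F f)).trans
      ((Category.comp_id _).trans (lam_freePi_assoc F _ _).symm)))

/-- The only part of the distributive law not already a comonad or monad law; it serves both `mul`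
and `comul`. -/
lemma freePi_freeSigma (f : Arrow C) :
    freePi F f ≫ freeSigma F f = freeSigma F (freeR F f) ≫
      freeMap F ((freeComonadMonadFactorisation F).exchange.app f) ≫ freePi F (freeL F f) :=
  (F (freeR F f)).hom_ext
    ((liftMap_freePi F f).id_comp (liftMap_freeSigma F f))
    ((liftMap_freeSigma F (freeR F f)).id_comp (.comp_map
      ((liftMap_freeMap F ((freeComonadMonadFactorisation F).exchange.app f)).comp_id
        (liftMap_freePi F (freeL F f))) (liftMap_freePi F f)))
    ((lam_freePi_assoc F f _).trans ((lam_freeSigma_assoc F (freeR F f) _).trans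
      ((lam_freeMap_assoc F ((freeComonadMonadFactorisation F).exchange.app f) _).trans ((congrArg (freeSigma F f ≫ ·)
        (lam_freePi F (freeL F f))).trans (Category.comp_id _)))).symm)

/-- The natural weak factorisation system given by free factorisations. -/
noncomputable def freeNaturalWFS : NaturalWFS C where
  toComonadMonadFactorisation := freeComonadMonadFactorisation F
  distributive :=
    { unit := fun f ↦ by
        ext
        · exact lam_freeSigma F f
        · exact (freeComonadMonadFactorisation F).map_unit_pi f
      mul := fun f ↦ by
        ext
        · exact freePi_freeSigma F f
        · exact ((freeComonadMonadFactorisation F).pi_assoc f).trans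
            (congrArg (freePi F (freeR F f) ≫ ·) (Category.comp_id _).symm)
      counit := fun f ↦ by
        ext
        · exact (freeComonadMonadFactorisation F).sigma_map_counit f
        · exact (freeComonadMonadFactorisation F).pi_rho f
      comul := fun f ↦ by
        ext
        · exact ((freeComonadMonadFactorisation F).sigma_coassoc f).trans
            (Category.id_comp _).symm
        · exact freePi_freeSigma F f }

end FreeNaturalWFS

/-! ### Liftings induced by coalgebras in an arbitrary natural w.f.s., and morphisms. -/

namespace NaturalWFS

variable {C : Type u} [Category.{v} C] {J : MorphismProperty C}

section Components

variable (N : NaturalWFS C) (f : Arrow C)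

/-- The left part of the factorisation of an arrow. -/
def l : f.left ⟶ N.P.obj f := N.lam.app f

/-- The right part of the factorisation of an arrow. -/
def r : N.P.obj f ⟶ f.right := N.rho.app f

/-- The comultiplication on middle objects. -/
def s : N.P.obj f ⟶ N.P.obj (Arrow.mk (N.l f)) := N.sigma.app f

/-- The multiplication on middle objects. -/
def p : N.P.obj (Arrow.mk (N.r f)) ⟶ N.P.obj f := N.pi.app f

variable {f} {g : Arrow C} (t : f ⟶ g)

/-- The square between left parts induced by a square. -/
abbrev lMap : Arrow.mk (N.l f) ⟶ Arrow.mk (N.l g) :=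
  Arrow.homMk t.left (N.P.map t) (N.lam.naturality t)

/-- The square between right parts induced by a square. -/
abbrev rMap : Arrow.mk (N.r f) ⟶ Arrow.mk (N.r g) :=
  Arrow.homMk (N.P.map t) t.right (N.rho.naturality t)

lemma l_map : N.l f ≫ N.P.map t = t.left ≫ N.l g := (N.lam.naturality t).symm

lemma map_r : N.P.map t ≫ N.r g = N.r f ≫ t.right := N.rho.naturality t

lemma map_s : N.P.map t ≫ N.s g = N.s f ≫ N.P.map (N.lMap t) := N.sigma.naturality t

lemma p_map : N.p f ≫ N.P.map t = N.P.map (N.rMap t) ≫ N.p g := (N.pi.naturality t).symm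

variable (f)

lemma l_s : N.l f ≫ N.s f = N.l (Arrow.mk (N.l f)) := N.lam_sigma f

lemma p_r : N.p f ≫ N.r f = N.r (Arrow.mk (N.r f)) := N.pi_rho f

lemma s_r : N.s f ≫ N.r (Arrow.mk (N.l f)) = 𝟙 _ := N.sigma_rho f

lemma l_p : N.l (Arrow.mk (N.r f)) ≫ N.p f = 𝟙 _ := N.lam_pi f

/-- The square exhibiting the multiplication as an algebra map. -/
abbrev pSq : Arrow.mk (N.r (Arrow.mk (N.r f))) ⟶ Arrow.mk (N.r f) :=
  Arrow.homMk (N.p f) (𝟙 _) ((N.p_r f).trans (Category.comp_id _).symm)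

/-- The exchange square. -/
abbrev exSq : Arrow.mk (N.l (Arrow.mk (N.r f))) ⟶ Arrow.mk (N.r (Arrow.mk (N.l f))) :=
  Arrow.homMk (N.s f) (N.p f) ((N.s_r f).trans (N.l_p f).symm)

lemma p_p : N.p (Arrow.mk (N.r f)) ≫ N.p f = N.P.map (N.pSq f) ≫ N.p f := (N.pi_assoc f).symm

/-- The sole consequence of distributivity needed from an arbitrary natural w.f.s. -/
lemma p_s : N.p f ≫ N.s f = N.s (Arrow.mk (N.r f)) ≫ N.P.map (N.exSq f) ≫ N.p (Arrow.mk (N.l f)) :=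
  congrArg Arrow.Hom.left (N.distributive.mul f)

end Components

section Coalgebras

variable {N : NaturalWFS C} (c : N.Coalgebras J)

namespace Coalgebras

section

variable {A B : C} (j : A ⟶ B) (hj : J j)

/-- The map underlying a coalgebra structure. -/
def fill : B ⟶ N.P.obj (Arrow.mk j) := (c j hj).a.right

lemma left_a : (c j hj).a.left = 𝟙 A :=
  (Category.comp_id _).symm.trans (congrArg Arrow.Hom.left (c j hj).counit)

lemma comp_fill : j ≫ c.fill j hj = N.l (Arrow.mk j) :=
  (Arrow.w (c j hj).a).symm.trans ((congrArg (· ≫ N.l (Arrow.mk j)) (c.left_a j hj)).trans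
    (Category.id_comp _))

lemma fill_r : c.fill j hj ≫ N.r (Arrow.mk j) = 𝟙 B :=
  congrArg Arrow.Hom.right (c j hj).counit

/-- The square underlying a coalgebra structure. -/
abbrev fillSq : Arrow.mk j ⟶ Arrow.mk (N.l (Arrow.mk j)) :=
  Arrow.homMk (𝟙 A) (c.fill j hj) ((Category.id_comp _).trans (c.comp_fill j hj).symm)

lemma a_eq : (c j hj).a = c.fillSq j hj := by
  ext
  · exact c.left_a j hj
  · rfl

lemma fill_s : c.fill j hj ≫ N.s (Arrow.mk j) = c.fill j hj ≫ N.P.map (c.fillSq j hj) :=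
  (congrArg Arrow.Hom.right (c j hj).coassoc).trans
    (congrArg (fun x ↦ c.fill j hj ≫ N.P.map x) (c.a_eq j hj))

end

/-- The choice of liftings on the right part of a factorisation induced by coalgebra structures. -/
def lifting (f : Arrow C) : ChoiceOfLiftings J (N.r f) where
  lift j hj h k w := c.fill j hj ≫
    N.P.map (Arrow.homMk h k w : Arrow.mk j ⟶ Arrow.mk (N.r f)) ≫ N.p f
  comp_lift j hj h k w := by
    rw [← Category.assoc, comp_fill, ← Category.assoc, l_map, Category.assoc, l_p]
    exact Category.comp_id _
  lift_comp j hj h k w := by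
    rw [Category.assoc, Category.assoc, p_r, map_r, ← Category.assoc, fill_r]
    exact Category.id_comp _

lemma lift_lifting {A B : C} (j : A ⟶ B) (hj : J j) (f : Arrow C) (h : A ⟶ N.P.obj f)
    (k : B ⟶ f.right) (w : h ≫ N.r f = j ≫ k) :
    (c.lifting f).lift j hj h k w = c.fill j hj ≫
      N.P.map (Arrow.homMk h k w : Arrow.mk j ⟶ Arrow.mk (N.r f)) ≫ N.p f := rfl

lemma liftMap_map {f g : Arrow C} (t : f ⟶ g) :
    LiftMap (c.lifting f) (c.lifting g) (N.P.map t) t.right := by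
  refine ⟨N.map_r t, fun A B j hj h k w w' ↦ ?_⟩
  rw [lift_lifting, lift_lifting, Category.assoc, Category.assoc, p_map, ← N.P.map_comp_assoc]
  rfl

lemma liftMap_p (f : Arrow C) :
    LiftMap (c.lifting (Arrow.mk (N.r f))) (c.lifting f) (N.p f) (𝟙 f.right) := by
  refine ⟨(N.p_r f).trans (Category.comp_id _).symm, fun A B j hj h k w w' ↦ ?_⟩
  rw [lift_lifting, lift_lifting, Category.assoc, Category.assoc, p_p, ← N.P.map_comp_assoc]
  rfl

/-- Distributivity (`p_s`) moves `s` past `p`, and coassociativity (`fill_s`) turns `fill ≫ s` into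
a second use of the filler. The resulting square has as its base the lifting against `N.r f`, as the
composite choice prescribes. -/
lemma liftMap_s (f : Arrow C) :
    LiftMap (c.lifting f) ((c.lifting (Arrow.mk (N.l f))).comp (c.lifting f)) (N.s f)
      (𝟙 f.right) := by
  refine ⟨?_, fun A B j hj h k w w' ↦ ?_⟩
  · rw [← Category.assoc, s_r, Category.comp_id]
    exact Category.id_comp _
  · have w₁ : ((h ≫ N.s f) ≫ N.r (Arrow.mk (N.l f))) ≫ N.r f = j ≫ k ≫ 𝟙 f.right := by
      rw [Category.assoc, w']
    have e : (c.lifting f).lift j hj ((h ≫ N.s f) ≫ N.r (Arrow.mk (N.l f))) (k ≫ 𝟙 _) w₁ =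
        (c.lifting f).lift j hj h k w :=
      (c.lifting f).lift_congr _ _ _ _
        (by rw [Category.assoc, s_r]; exact Category.comp_id _) (Category.comp_id _)
    change _ = (c.lifting (Arrow.mk (N.l f))).lift j hj (h ≫ N.s f)
      ((c.lifting f).lift j hj _ _ w₁) _
    rw [lift_lifting, lift_lifting, Category.assoc, Category.assoc, p_s, ← Category.assoc (N.P.map _),
      map_s, Category.assoc, ← Category.assoc, fill_s, Category.assoc, ← N.P.map_comp_assoc,
      ← N.P.map_comp_assoc]
    congr 3
    ext
    · exact congrArg (fun x ↦ x ≫ _) (Category.id_comp _)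
    · exact (Category.assoc _ _ _).trans e.symm

end Coalgebras

end Coalgebras

namespace Hom

section

variable {N N' : NaturalWFS C} (K : Hom N N')

lemma map_app {f g : Arrow C} (t : f ⟶ g) : N.P.map t ≫ K.app g = K.app f ≫ N'.P.map t :=
  K.naturality t

lemma l_app (f : Arrow C) : N.l f ≫ K.app f = N'.l f := K.lam_app f

lemma app_r (f : Arrow C) : K.app f ≫ N'.r f = N.r f := K.app_rho f

/-- The square between left parts induced by a morphism of natural w.f.s. -/
abbrev lSq (f : Arrow C) : Arrow.mk (N.l f) ⟶ Arrow.mk (N'.l f) :=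
  Arrow.homMk (𝟙 _) (K.app f) ((Category.id_comp _).trans (K.lam_app f).symm)

/-- The square between right parts induced by a morphism of natural w.f.s. -/
abbrev rSq (f : Arrow C) : Arrow.mk (N.r f) ⟶ Arrow.mk (N'.r f) :=
  Arrow.homMk (K.app f) (𝟙 _) ((K.app_rho f).trans (Category.comp_id _).symm)

lemma app_s (f : Arrow C) : K.app f ≫ N'.s f =
    N.s f ≫ K.app (Arrow.mk (N.l f)) ≫ N'.P.map (K.lSq f) := K.app_sigma f

lemma p_app (f : Arrow C) : N.p f ≫ K.app f =
    N.P.map (K.rSq f) ≫ K.app (Arrow.mk (N'.r f)) ≫ N'.p f :=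
  (K.pi_app f).trans (Category.assoc _ _ _)

end

@[ext]
lemma ext' {N N' : NaturalWFS C} {K K' : Hom N N'} (h : ∀ f, K.app f = K'.app f) : K = K' := by
  obtain ⟨⟨a, _⟩, _⟩ := K
  obtain ⟨⟨b, _⟩, _⟩ := K'
  obtain rfl : a = b := funext h
  rfl

/-- The identity morphism. -/
def id (N : NaturalWFS C) : Hom N N where
  app f := 𝟙 _
  naturality f g t := (Category.comp_id _).trans (Category.id_comp _).symm
  lam_app f := Category.comp_id _
  app_rho f := Category.id_comp _
  app_sigma f := by
    change 𝟙 (N.P.obj f) ≫ N.s f = N.s f ≫ 𝟙 (N.P.obj (Arrow.mk (N.l f))) ≫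
      N.P.map (𝟙 (Arrow.mk (N.l f)))
    simp
  pi_app f := by
    change N.p f ≫ 𝟙 (N.P.obj f) = (N.P.map (𝟙 (Arrow.mk (N.r f))) ≫
      𝟙 (N.P.obj (Arrow.mk (N.r f)))) ≫ N.p f
    simp

/-- The composite of two morphisms. -/
def comp {N N' N'' : NaturalWFS C} (K : Hom N N') (K' : Hom N' N'') : Hom N N'' where
  app f := K.app f ≫ K'.app f
  naturality f g t := by
    rw [← Category.assoc, map_app, Category.assoc, map_app, Category.assoc]
  lam_app f := by
    refine (Category.assoc _ _ _).symm.trans ?_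
    rw [K.lam_app, K'.lam_app]
  app_rho f := by
    refine (Category.assoc _ _ _).trans ?_
    rw [K'.app_rho, K.app_rho]
  app_sigma f := by
    have w : 𝟙 _ ≫ N''.l f = N.l f ≫ K.app f ≫ K'.app f := by
      rw [← Category.assoc, K.l_app, K'.l_app, Category.id_comp]
    have e : K.lSq f ≫ K'.lSq f = (Arrow.homMk (𝟙 _) (K.app f ≫ K'.app f) w :
        Arrow.mk (N.l f) ⟶ Arrow.mk (N''.l f)) := by
      ext
      · exact Category.id_comp _
      · rfl
    change (K.app f ≫ K'.app f) ≫ N''.s f = N.s f ≫ (K.app _ ≫ K'.app _) ≫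
      N''.P.map (Arrow.homMk (𝟙 _) (K.app f ≫ K'.app f) w :
        Arrow.mk (N.l f) ⟶ Arrow.mk (N''.l f))
    rw [← e, N''.P.map_comp, Category.assoc, K'.app_s, ← Category.assoc, K.app_s]
    simp only [Category.assoc]
    rw [← Category.assoc (N'.P.map _), K'.map_app, Category.assoc]
  pi_app f := by
    have w : (K.app f ≫ K'.app f) ≫ N''.r f = N.r f ≫ 𝟙 _ := by
      rw [Category.assoc, K'.app_r, K.app_r, Category.comp_id]
    have e : K.rSq f ≫ K'.rSq f = (Arrow.homMk (K.app f ≫ K'.app f) (𝟙 _) w :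
        Arrow.mk (N.r f) ⟶ Arrow.mk (N''.r f)) := by
      ext
      · rfl
      · exact Category.id_comp _
    change N.p f ≫ K.app f ≫ K'.app f = (N.P.map (Arrow.homMk (K.app f ≫ K'.app f) (𝟙 _) w :
        Arrow.mk (N.r f) ⟶ Arrow.mk (N''.r f)) ≫ K.app _ ≫ K'.app _) ≫ N''.p f
    rw [← e, N.P.map_comp, ← Category.assoc, K.p_app]
    simp only [Category.assoc]
    rw [K'.p_app, ← Category.assoc (N.P.map (K'.rSq f)), K.map_app, Category.assoc]

variable {N N' : NaturalWFS C}

/-- A morphism of natural w.f.s. maps given coalgebra structures to given coalgebra structures. -/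
abbrev PreservesCoalgebras (K : Hom N N') (c : N.Coalgebras J) (c' : N'.Coalgebras J) : Prop :=
  ∀ ⦃A B : C⦄ (j : A ⟶ B) (hj : J j),
    (c j hj).a ≫ K.comonadHom.app (Arrow.mk j) = (c' j hj).a

/-- The counit law makes the domain component of a coalgebra an identity, so only the codomain
component carries information. -/
lemma preservesCoalgebras_iff (K : Hom N N') (c : N.Coalgebras J) (c' : N'.Coalgebras J) :
    K.PreservesCoalgebras c c' ↔ ∀ ⦃A B : C⦄ (j : A ⟶ B) (hj : J j),
      c.fill j hj ≫ K.app (Arrow.mk j) = c'.fill j hj := by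
  refine ⟨fun h A B j hj ↦ congrArg Arrow.Hom.right (h j hj), fun h A B j hj ↦ ?_⟩
  ext
  · exact ((Category.comp_id _).trans (c.left_a j hj)).trans (c'.left_a j hj).symm
  · exact h j hj

/-- A morphism of natural w.f.s. preserving coalgebra structures preserves liftings. -/
lemma PreservesCoalgebras.liftMap {K : Hom N N'} {c : N.Coalgebras J} {c' : N'.Coalgebras J}
    (hK : K.PreservesCoalgebras c c') (f : Arrow C) :
    LiftMap (c.lifting f) (c'.lifting f) (K.app f) (𝟙 _) := by
  rw [preservesCoalgebras_iff] at hK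
  refine ⟨(K.app_r f).trans (Category.comp_id _).symm, fun A B j hj h k w w' ↦ ?_⟩
  rw [Coalgebras.lift_lifting, Coalgebras.lift_lifting, Category.assoc, Category.assoc, p_app,
    ← hK, Category.assoc, ← N.P.map_comp_assoc, ← Category.assoc (N.P.map _), K.map_app,
    Category.assoc]
  rfl

end Hom

end NaturalWFS

/-! ### The universal property of the free natural w.f.s. -/

section Universality

variable {C : Type u} [Category.{v} C] {J : MorphismProperty C}
  (F : ∀ f : Arrow C, FreeFactorisation J f)

/-- The underlying map of the coalgebra structure on a generating map. -/
noncomputable def freeFill {A B : C} (j : A ⟶ B) (hj : J j) : B ⟶ (F (Arrow.mk j)).P :=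
  (F (Arrow.mk j)).lifting.lift j hj (F (Arrow.mk j)).lam (𝟙 B)
    ((F (Arrow.mk j)).fac.trans (Category.comp_id _).symm)

lemma comp_freeFill {A B : C} (j : A ⟶ B) (hj : J j) :
    j ≫ freeFill F j hj = (F (Arrow.mk j)).lam :=
  (F (Arrow.mk j)).lifting.comp_lift _ _ _ _ _

/-- `freeFill` is itself a chosen lifting, so lifting-preserving maps send it to chosen liftings. -/
lemma freeFill_comp {A B : C} (j : A ⟶ B) (hj : J j) {Z W : C} {g : Z ⟶ W}
    {ψ : ChoiceOfLiftings J g} {u : (F (Arrow.mk j)).P ⟶ Z} {k : B ⟶ W}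
    (H : LiftMap (F (Arrow.mk j)).lifting ψ u k) {h : A ⟶ Z} (e : (F (Arrow.mk j)).lam ≫ u = h)
    (w : h ≫ g = j ≫ k) : freeFill F j hj ≫ u = ψ.lift j hj h k w := by
  refine (H.preserves _ _ _ _ _ ?_).trans ?_
  · rw [e, w, Category.id_comp]
  · exact ψ.lift_congr _ _ _ _ e (Category.id_comp _)

/-- The square underlying the coalgebra structure on a generating map. -/
noncomputable abbrev freeFillSq {A B : C} (j : A ⟶ B) (hj : J j) :
    Arrow.mk j ⟶ freeL F (Arrow.mk j) :=
  Arrow.homMk (𝟙 A) (freeFill F j hj)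
    ((Category.id_comp _).trans (comp_freeFill F j hj).symm)

/-- The coalgebra structures on the generating maps. -/
noncomputable def freeCoalgebras : (freeNaturalWFS F).Coalgebras J := fun A B j hj ↦
  { a := freeFillSq F j hj
    counit := by
      ext
      · exact Category.id_comp _
      · exact (F (Arrow.mk j)).lifting.lift_comp _ _ _ _ _
    coassoc := by
      ext
      · rfl
      -- Both sides become chosen liftings against `rho (lam j)`. In the composite choice the inner
      -- lifting is `freeFill`, which is the base of the other square.
      · have w : (F (freeL F (Arrow.mk j))).lam ≫ (F (freeL F (Arrow.mk j))).rho ≫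
            (F (Arrow.mk j)).rho = j ≫ 𝟙 B := by
          rw [← Category.assoc, (F (freeL F (Arrow.mk j))).fac]
          exact (F (Arrow.mk j)).fac.trans (Category.comp_id _).symm
        refine (freeFill_comp F j hj (liftMap_freeSigma F (Arrow.mk j))
          (lam_freeSigma F (Arrow.mk j)) w).trans (Eq.trans ?_
          (freeFill_comp F j hj (k := freeFill F j hj)
            (liftMap_freeMap F (freeFillSq F j hj)) (lam_freeMap F (freeFillSq F j hj)) ?_).symm)
        · refine (F (freeL F (Arrow.mk j))).lifting.lift_congr _ _ _ _
            (Category.id_comp _).symm ?_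
          exact (F (Arrow.mk j)).lifting.lift_congr _ _ _ _ (F (freeL F (Arrow.mk j))).fac rfl
        · exact (congrArg (· ≫ (F (freeL F (Arrow.mk j))).rho) (Category.id_comp _)).trans
            ((F (freeL F (Arrow.mk j))).fac.trans (comp_freeFill F j hj).symm) }

/-- The coalgebras recover the free liftings: `freeMap` followed by `freePi` preserves liftings and
restricts to `h` along `lam`. Uniqueness in the universal property rests on this. -/
lemma lifting_freeCoalgebras (f : Arrow C) {A B : C} (j : A ⟶ B) (hj : J j) (h : A ⟶ (F f).P)
    (k : B ⟶ f.right) (w : h ≫ (F f).rho = j ≫ k) :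
    ((freeCoalgebras F).lifting f).lift j hj h k w = (F f).lifting.lift j hj h k w := by
  refine freeFill_comp F j hj ((liftMap_freeMap F _).comp_id (liftMap_freePi F f)) ?_ w
  refine (lam_freeMap_assoc F _ _).trans ?_
  exact (congrArg (h ≫ ·) (lam_freePi F f)).trans (Category.comp_id _)

lemma liftMap_freeCoalgebras (f : Arrow C) :
    LiftMap (F f).lifting ((freeCoalgebras F).lifting f) (𝟙 (F f).P) (𝟙 f.right) :=
  ⟨(Category.id_comp _).trans (Category.comp_id _).symm, fun _ _ j hj _ _ _ w' ↦
    ((Category.comp_id _).trans ((F f).lifting.lift_congr _ _ _ _ (Category.comp_id _).symm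
      (Category.comp_id _).symm)).trans (lifting_freeCoalgebras F f j hj _ _ w').symm⟩

section

variable {N : NaturalWFS C} (c : N.Coalgebras J)

/-- The comparison from the free factorisation to a factorisation with coalgebra structures. -/
noncomputable def freeDesc (f : Arrow C) : (F f).P ⟶ N.P.obj f :=
  (F f).desc (c.lifting f) (N.l f) (𝟙 _) ((N.fac f).trans (Category.comp_id _).symm)

lemma lam_freeDesc (f : Arrow C) : (F f).lam ≫ freeDesc F c f = N.l f := (F f).lam_desc _ _ _ _

lemma lam_freeDesc_assoc (f : Arrow C) {Z : C} (u : N.P.obj f ⟶ Z) :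
    (F f).lam ≫ freeDesc F c f ≫ u = N.l f ≫ u := by
  rw [← Category.assoc, lam_freeDesc]

lemma liftMap_freeDesc (f : Arrow C) :
    LiftMap (F f).lifting (c.lifting f) (freeDesc F c f) (𝟙 f.right) :=
  (F f).liftMap_desc _ _ _ _

/-- The square between right parts given by the comparison. -/
noncomputable abbrev freeDescSq (f : Arrow C) : freeR F f ⟶ Arrow.mk (N.r f) :=
  Arrow.homMk (freeDesc F c f) (𝟙 _) (liftMap_freeDesc F c f).sq

/-- The morphism from the free natural w.f.s. to a natural w.f.s. with coalgebra structures. -/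
noncomputable def freeHom : NaturalWFS.Hom (freeNaturalWFS F) N where
  app f := freeDesc F c f
  naturality f g t := (F f).hom_ext
    ((liftMap_freeMap F t).comp_id (liftMap_freeDesc F c g))
    ((liftMap_freeDesc F c f).id_comp (c.liftMap_map t))
    ((lam_freeMap_assoc F t _).trans ((congrArg (t.left ≫ ·) (lam_freeDesc F c g)).trans
      ((lam_freeDesc_assoc F c f _).trans (N.l_map t)).symm))
  lam_app f := lam_freeDesc F c f
  app_rho f := (liftMap_freeDesc F c f).sq.trans (Category.comp_id _)
  app_sigma f := (F f).hom_ext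
    ((liftMap_freeDesc F c f).comp_id (c.liftMap_s f))
    ((liftMap_freeSigma F f).id_comp (.comp_map
      ((liftMap_freeDesc F c (freeL F f)).id_comp (c.liftMap_map _)) (liftMap_freeDesc F c f)))
    ((lam_freeDesc_assoc F c f _).trans ((N.l_s f).trans ((lam_freeSigma_assoc F f _).trans
      ((lam_freeDesc_assoc F c (freeL F f) _).trans
        ((N.l_map _).trans (Category.id_comp _)))).symm))
  pi_app f := (F (freeR F f)).hom_ext
    ((liftMap_freePi F f).comp_id (liftMap_freeDesc F c f))
    (((liftMap_freeMap F (freeDescSq F c f)).comp_id (liftMap_freeDesc F c (Arrow.mk (N.r f)))).comp_id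
      (c.liftMap_p f))
    ((lam_freePi_assoc F f _).trans (((congrArg _ (Category.assoc _ _ _)).trans
      ((lam_freeMap_assoc F (freeDescSq F c f) _).trans
        ((congrArg (freeDesc F c f ≫ ·) ((lam_freeDesc_assoc F c _ _).trans (N.l_p f))).trans
          (Category.comp_id _)))).symm))

/-- The image of `freeFill` is the induced lifting of the unit square, which is `c.fill j hj` by the
unit law `map_unit_pi`. -/
lemma freeHom_preservesCoalgebras :
    (freeHom F c).PreservesCoalgebras (freeCoalgebras F) c := by
  rw [NaturalWFS.Hom.preservesCoalgebras_iff]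
  intro A B j hj
  refine (freeFill_comp F j hj (liftMap_freeDesc F c (Arrow.mk j))
    (lam_freeDesc F c (Arrow.mk j)) ((N.fac _).trans (Category.comp_id _).symm)).trans ?_
  exact (congrArg (c.fill j hj ≫ ·) (N.map_unit_pi (Arrow.mk j))).trans (Category.comp_id _)

/-- Preserving coalgebras forces preserving induced liftings, and on the free side these are the
free ones, so `hom_ext` applies. -/
lemma eq_freeHom {K : NaturalWFS.Hom (freeNaturalWFS F) N}
    (hK : K.PreservesCoalgebras (freeCoalgebras F) c) : K = freeHom F c := by
  ext f
  have h := (liftMap_freeCoalgebras F f).comp_id (hK.liftMap f)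
  have e : 𝟙 (F f).P ≫ K.app f = K.app f := Category.id_comp _
  exact (F f).hom_ext ((congrArg (fun x ↦ LiftMap (F f).lifting (c.lifting f) x _) e).mp h) (liftMap_freeDesc F c f)
    ((K.l_app f).trans (lam_freeDesc F c f).symm)

end

/-- The left part of a factorisation lifts against every map that lifts against `J`. -/
lemma llp_lam (f : Arrow C) : J.rlp.llp (F f).lam := by
  intro Z W g hg
  let ψ : ChoiceOfLiftings J g :=
    { lift := fun j hj h k w ↦ have := hg j hj; (CommSq.mk w).lift
      comp_lift := fun j hj h k w ↦ have := hg j hj; (CommSq.mk w).fac_left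
      lift_comp := fun j hj h k w ↦ have := hg j hj; (CommSq.mk w).fac_right }
  -- Freeness of `rho (lam f)` extends the square `(a, b)` to `P (lam f)`; precomposing with
  -- `sigma`, a section of `rho (lam f)`, gives the filler.
  refine ⟨fun {a b} sq ↦ ⟨⟨freeSigma F f ≫ (F (freeL F f)).desc ψ a b sq.w, ?_, ?_⟩⟩⟩
  · exact (lam_freeSigma_assoc F f _).trans ((F (freeL F f)).lam_desc _ _ _ _)
  · rw [Category.assoc, ((F (freeL F f)).liftMap_desc ψ a b sq.w).sq, ← Category.assoc]
    exact (congrArg (· ≫ b) ((freeComonadMonadFactorisation F).sigma_rho f)).trans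
      (Category.id_comp _)

lemma isUniversalRealisation_free :
    NaturalWFS.IsUniversalRealisation J (freeNaturalWFS F) (freeCoalgebras F) where
  realises :=
    { lam_mem := llp_lam F
      rho_mem := fun f _ _ j hj ↦ ⟨fun {h k} sq ↦ ⟨⟨(F f).lifting.lift j hj h k sq.w,
        (F f).lifting.comp_lift _ _ _ _ _, (F f).lifting.lift_comp _ _ _ _ _⟩⟩⟩ }
  free _ c := ⟨freeHom F c, freeHom_preservesCoalgebras F c, fun _ h ↦ eq_freeHom F c h⟩

end Universality

/-! ### Transfer of freeness to every universal realisation, and initiality. -/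

section InitialObjects

variable {C : Type u} [Category.{v} C] {J : MorphismProperty C}

lemma AAF.Hom.liftMap {X : C} {p q : AAF J X} (m : p ⟶ q) :
    LiftMap p.lifting q.lifting m.u (𝟙 X) :=
  ⟨m.w.trans (Category.comp_id _).symm, fun _ _ j hj h k w _ ↦ (m.lift_u j hj h k w).trans
    (q.lifting.lift_congr _ _ _ _ rfl (Category.comp_id _).symm)⟩

/-- The morphism of algebraic acyclic fibrations given by a map preserving liftings. -/
def AAF.homMk {X : C} {p q : AAF J X} (u : p.dom ⟶ q.dom)
    (h : LiftMap p.lifting q.lifting u (𝟙 X)) : p ⟶ q where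
  u := u
  w := h.sq.trans (Category.comp_id _)
  lift_u j hj a k sq := (h.preserves j hj a k sq (by
      rw [Category.assoc, h.sq, Category.comp_id, Category.comp_id, sq])).trans
    (q.lifting.lift_congr _ _ _ _ rfl (Category.comp_id _))

/-- A universal realisation is isomorphic to the one given by free factorisations. -/
lemma NaturalWFS.IsUniversalRealisation.exists_hom_free (F : ∀ f : Arrow C, FreeFactorisation J f)
    {N : NaturalWFS C} {c : N.Coalgebras J} (H : N.IsUniversalRealisation J c) :
    ∃ K : Hom N (freeNaturalWFS F), K.PreservesCoalgebras c (freeCoalgebras F) ∧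
      ∀ f, K.app f ≫ freeDesc F c f = 𝟙 _ := by
  obtain ⟨K, hK, -⟩ := H.free (freeNaturalWFS F) (freeCoalgebras F)
  refine ⟨K, hK, fun f ↦ ?_⟩
  -- The round trip and the identity both preserve `c`, so uniqueness identifies them. This
  -- one-sided inverse is all that is used.
  have h : (K.comp (freeHom F c)).PreservesCoalgebras c c := by
    have h₁ := (Hom.preservesCoalgebras_iff _ _ _).1 hK
    have h₂ := (Hom.preservesCoalgebras_iff _ _ _).1 (freeHom_preservesCoalgebras F c)
    refine (Hom.preservesCoalgebras_iff _ _ _).2 fun A B j hj ↦ ?_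
    exact (Category.assoc _ _ _).symm.trans ((congrArg (· ≫ _) (h₁ j hj)).trans (h₂ j hj))
  have h' : (Hom.id N).PreservesCoalgebras c c :=
    (Hom.preservesCoalgebras_iff _ _ _).2 fun _ _ _ _ ↦ Category.comp_id _
  exact congrArg (fun K : Hom N N ↦ K.app f) ((H.free N c).unique h h')

/-- The right parts of a universal realisation are free algebraic acyclic fibrations. -/
lemma NaturalWFS.IsUniversalRealisation.existsUnique_liftMap
    (F : ∀ f : Arrow C, FreeFactorisation J f) {N : NaturalWFS C} {c : N.Coalgebras J}
    (H : N.IsUniversalRealisation J c) (f : Arrow C) {Z W : C} {g : Z ⟶ W}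
    (ψ : ChoiceOfLiftings J g) (a : f.left ⟶ Z) (b : f.right ⟶ W) (w : a ≫ g = f.hom ≫ b) :
    ∃! u : N.P.obj f ⟶ Z, N.l f ≫ u = a ∧ LiftMap (c.lifting f) ψ u b := by
  obtain ⟨K, hK, e⟩ := H.exists_hom_free F
  have hl : LiftMap ((freeCoalgebras F).lifting f) (F f).lifting (𝟙 (F f).P) (𝟙 f.right) :=
    ⟨(Category.id_comp _).trans (Category.comp_id _).symm, fun A B j hj h k w w' ↦
      ((Category.comp_id _).trans (lifting_freeCoalgebras F f j hj h k w)).trans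
        ((F f).lifting.lift_congr _ _ _ _ (Category.comp_id _).symm (Category.comp_id _).symm)⟩
  have hd := (F f).liftMap_desc ψ a b w
  refine ⟨K.app f ≫ (F f).desc ψ a b w, ⟨?_, ?_⟩, ?_⟩
  · exact (Category.assoc _ _ _).symm.trans
      ((congrArg (· ≫ _) (K.l_app f)).trans ((F f).lam_desc ψ a b w))
  · exact (hK.liftMap f).id_comp ((congrArg (fun x ↦ LiftMap _ ψ x b)
      (Category.id_comp ((F f).desc ψ a b w))).mp (hl.id_comp hd))
  -- Freeness determines `freeDesc F c f ≫ u`, and `K.app f` is a section of `freeDesc F c f`.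
  · rintro u ⟨hu, hu'⟩
    have h : freeDesc F c f ≫ u = (F f).desc ψ a b w :=
      (F f).hom_ext ((liftMap_freeDesc F c f).id_comp hu') hd
        ((lam_freeDesc_assoc F c f u).trans (hu.trans ((F f).lam_desc ψ a b w).symm))
    rw [← h]
    exact ((Category.assoc _ _ _).symm.trans
      ((congrArg (· ≫ u) (e f)).trans (Category.id_comp _))).symm

end InitialObjects

attribute [local instance] Cardinal.fact_isRegular_aleph0 in
lemma nonempty_freeFactorisation_of_isLocallyFinitelyPresentable {C : Type u} [Category.{v} C]
    [IsLocallyFinitelyPresentable.{v} C] (J : MorphismProperty C) [MorphismProperty.IsSmall.{v} J]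
    (f : Arrow C) : Nonempty (FreeFactorisation J f) := by
  have : IsLocallyPresentable.{v} C := ⟨Cardinal.aleph0.{v}, inferInstance, inferInstance⟩
  have : HasColimitsOfSize.{v, v} C :=
    IsCardinalLocallyPresentable.toHasColimitsOfSize (κ := Cardinal.aleph0.{v})
  exact nonempty_freeFactorisation f

end AlgebraicWFS

theorem mainTheorem6 {C : Type u} [Category.{v} C] [IsLocallyFinitelyPresentable.{v} C]
    (J : MorphismProperty C) [MorphismProperty.IsSmall.{v} J] :
    (∃ (N : AlgebraicWFS.NaturalWFS C) (c : N.Coalgebras J), AlgebraicWFS.NaturalWFS.IsUniversalRealisation J N c) ∧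
    ∀ (N : AlgebraicWFS.NaturalWFS C) (c : N.Coalgebras J),
      AlgebraicWFS.NaturalWFS.IsUniversalRealisation J N c →
      ∀ X : C, ∃ φ : AlgebraicWFS.ChoiceOfLiftings J (N.cofibrantReplacement.ε.app X),
        Nonempty (IsInitial
          (AlgebraicWFS.AAF.mk (J := J) (N.cofibrantReplacement.ε.app X) φ)) := by
  let F (f : Arrow C) : AlgebraicWFS.FreeFactorisation J f :=
    (AlgebraicWFS.nonempty_freeFactorisation_of_isLocallyFinitelyPresentable J f).some
  refine ⟨⟨_, _, AlgebraicWFS.isUniversalRealisation_free F⟩, fun N c H X ↦ ?_⟩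
  let f := (AlgebraicWFS.NaturalWFS.fromInitial C).obj X
  -- The counit at `X` is `N.r f`, so the coalgebra liftings apply. Since the domain of `f` is
  -- initial, the condition along `N.l f` is automatic.
  refine ⟨c.lifting f, ⟨IsInitial.ofUniqueHom (fun q ↦ AlgebraicWFS.AAF.homMk
    (H.existsUnique_liftMap F f q.lifting (initial.to q.dom) (𝟙 X)
      (initial.hom_ext _ _)).choose ?_) fun q m ↦ ?_⟩⟩
  · exact (H.existsUnique_liftMap F f q.lifting (initial.to q.dom) (𝟙 X)
      (initial.hom_ext _ _)).choose_spec.1.2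
  · exact AlgebraicWFS.AAF.Hom.ext ((H.existsUnique_liftMap F f q.lifting (initial.to q.dom) (𝟙 X)
      (initial.hom_ext _ _)).choose_spec.2 m.u ⟨initial.hom_ext _ _, AlgebraicWFS.AAF.Hom.liftMap m⟩)
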